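/- For integers $d,k\ge 1$ let $\Xi_{d,k}$ be the maximal possible number (a priori in $\mathbb Z_{\ge 0}\cup\{\infty\}$) of non-degenerate solutions in $\mathbb R_{>0}^d$ of a system $f_1=\dots=f_d=0$ of polynomials $f_1,\dots,f_d\in\mathbb R[X_1,\dots,X_d]$ that involve, all together, at most $d+k+1$ monomials with nonzero coefficients; a solution is non-degenerate if the Jacobian matrix of the system is invertible at it. For integers $i,j\ge 0$ let $$D_{i,j}=\sum_{\ell=0}^{\min\{i,j\}}2^\ell\binom i\ell\binom j\ell,\qquad F_{i,j}=D_{i,j}+D_{i-1,j-1},$$ where $D_{i,j}$ (a Delannoy number) is $0$ if an index is negative. (a) For all integers $h>0$ and $k>1$, $$\Xi_{2k,2h}\ \ge\ \Xi_{2k-1,2h}\ \ge\ F_{h,k}\ \ge\ D_{h,k}.$$ (b) For all integers $i,j>0$, $$\Xi_{2i-1,2j-1}\ge\frac{j}{i+j}\,F_{i,j},\qquad \Xi_{2i,2j}\ge\frac{i+1}{i+j+1}\,F_{i+1,j},\qquad \Xi_{2i,2j-1}\ge 2\,F_{i,j-1},$$ and, if moreover $i>1$, $$\Xi_{2i-1,2j}\ge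 F_{i,j}.$$ -/

import Mathlib

open scoped ENNReal

/-- The set of exponent vectors of the monomials that appear with a nonzero coefficient in at least
one of the polynomials `f 0, …, f (d - 1)`. -/
noncomputable def systemSupport {d : ℕ} (f : Fin d → MvPolynomial (Fin d) ℝ) :
    Finset (Fin d →₀ ℕ) :=
  Finset.univ.biUnion fun i => (f i).support

/-- The Jacobian matrix `(∂ f i / ∂ X j)` of the system `f` at the point `x`. -/
noncomputable def systemJacobian {d : ℕ} (f : Fin d → MvPolynomial (Fin d) ℝ) (x : Fin d → ℝ) :
    Matrix (Fin d) (Fin d) ℝ :=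
  Matrix.of fun i j => MvPolynomial.eval x (MvPolynomial.pderiv j (f i))

/-- The set of non-degenerate positive solutions of the system `f = 0`: the solutions in the open
positive orthant at which the Jacobian matrix is invertible. -/
def nondegPosSolutions {d : ℕ} (f : Fin d → MvPolynomial (Fin d) ℝ) : Set (Fin d → ℝ) :=
  {x | (∀ j, 0 < x j) ∧ (∀ i, MvPolynomial.eval x (f i) = 0) ∧ IsUnit (systemJacobian f x)}

/-- `Xi d k` is the maximal possible number of non-degenerate positive solutions of a system of
`d` real polynomial equations in `d` variables that involves at most `d + k + 1` monomials.
It is a supremum in `ℕ∞`, so that no boundedness has to be assumed: `N ≤ Xi d k` for a natural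
number `N` holds exactly when some such system has at least `N` such solutions. -/
noncomputable def Xi (d k : ℕ) : ℕ∞ :=
  ⨆ (f : Fin d → MvPolynomial (Fin d) ℝ) (_ : (systemSupport f).card ≤ d + k + 1),
    (nondegPosSolutions f).encard

/-- The Delannoy number `D_{i,j} = ∑_{ℓ ≤ min i j} 2 ^ ℓ * (i choose ℓ) * (j choose ℓ)`. -/
def delannoy (i j : ℕ) : ℕ :=
  ∑ l ∈ Finset.range (min i j + 1), 2 ^ l * i.choose l * j.choose l

/-- `F_{i,j} = D_{i,j} + D_{i-1,j-1}`, where a Delannoy number with a negative index is `0`. -/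
def delannoyF : ℕ → ℕ → ℕ
  | i + 1, j + 1 => delannoy (i + 1) (j + 1) + delannoy i j
  | i, j => delannoy i j

/-! Viro's patchworking reduces the bounds to combinatorics. Give the monomials heights `h j` and
use coefficients `C i j * exp (-T * h j)` with `T` large. Every lower face of the lifted exponents
that is a simplex with `d + 1` vertices, and on which the columns of `C` have a one-dimensional
kernel spanned by a positive vector, then yields its own nondegenerate positive solution
(`card_le_Xi_of_decorated`). It remains to find many simplices that satisfy both conditions at once.

Both conditions come from cyclic polytopes. If the kernel of `C` is the space of polynomials of
degree at most `k` evaluated at nodes `τ`, then `S` is positively decorated when its complement is a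
facet of the cyclic polytope on `τ` (`exists_coefficients`). If the exponents and heights come from
projecting the cyclic polytope on nodes `s` from a point just beyond a facet `G`, then other facets
become lower faces (`exists_isLowerFace`).

On the nodes `0, …, 2 * (h + k) - 1` take `s` to be the identity and `τ` to be `pairSwap`. Delannoy
paths produce `delannoy h k` sets meeting both conditions, and paths closed up by a diagonal step
across the ends give the second summand of `delannoyF` (`delannoyF_le_card_pairedFacets`). When `h >
0` and `k > 1` some facet is not of this kind and can serve as `G`, so no solution is lost.

The fractional bounds follow by averaging over a vertex `v`: keep the sets avoiding `v`, or pass to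
the vertex figure for those containing it. The factor `2` comes from adjoining a variable with a
quadratic equation. The cases with `i = 1` that escape this are settled by univariate polynomials,
products, and one explicit pair of polynomials with eight solutions. -/

open Filter Topology

/-! ### Persistence of nondegenerate zeros of exponential sums -/

/-- The logarithmic Jacobian of the system of exponential sums with exponents `w` and
coefficients `b`. -/
noncomputable def expJacobian {d : ℕ} {κ : Type*} [Fintype κ] (w : κ → Fin d → ℝ)
    (b : Fin d → κ → ℝ) (y : Fin d → ℝ) : Matrix (Fin d) (Fin d) ℝ :=
  Matrix.of fun i l => ∑ j, b i j * w j l * Real.exp (∑ l, y l * w j l)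

theorem continuous_det_expJacobian {d : ℕ} {κ : Type*} [Fintype κ] (w : κ → Fin d → ℝ) :
    Continuous fun p : (Fin d → κ → ℝ) × (Fin d → ℝ) => (expJacobian w p.1 p.2).det := by
  apply Continuous.matrix_det
  apply continuous_matrix
  intro i l
  simp only [expJacobian, Matrix.of_apply]
  fun_prop

/-- Differentiation is joint in coefficients and point, but only the part along the point has to be
explicit: the coefficient directions are absorbed by the identity block in `Ψ` below. -/
theorem hasStrictFDerivAt_expTerm {d : ℕ} {κ : Type*} [Fintype κ] (w : κ → Fin d → ℝ)
    (i : Fin d) (j : κ) (p : (Fin d → κ → ℝ) × (Fin d → ℝ)) :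
    ∃ L : (Fin d → κ → ℝ) × (Fin d → ℝ) →L[ℝ] ℝ,
      HasStrictFDerivAt (fun p : (Fin d → κ → ℝ) × (Fin d → ℝ) =>
        p.1 i j * Real.exp (∑ l, p.2 l * w j l)) L p ∧
      ∀ η : Fin d → ℝ, L (0, η) =
        ∑ l, p.1 i j * w j l * Real.exp (∑ l, p.2 l * w j l) * η l := by
  let A : (Fin d → κ → ℝ) × (Fin d → ℝ) →L[ℝ] ℝ :=
    ((ContinuousLinearMap.proj j).comp (ContinuousLinearMap.proj (R := ℝ)
      (φ := fun _ : Fin d => κ → ℝ) i)).comp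
      (ContinuousLinearMap.fst ℝ (Fin d → κ → ℝ) (Fin d → ℝ))
  let B : (Fin d → κ → ℝ) × (Fin d → ℝ) →L[ℝ] ℝ :=
    (∑ l, w j l • ContinuousLinearMap.proj (R := ℝ) (φ := fun _ : Fin d => ℝ) l).comp
      (ContinuousLinearMap.snd ℝ (Fin d → κ → ℝ) (Fin d → ℝ))
  have hA : ∀ q, A q = q.1 i j := fun q => rfl
  have hB : ∀ q, B q = ∑ l, q.2 l * w j l := by
    intro q
    simp [B, mul_comm]
  have h := (A.hasStrictFDerivAt (x := p)).mul (B.hasStrictFDerivAt (x := p)).exp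
  refine ⟨_, h.congr_of_eventuallyEq (Eventually.of_forall fun q => ?_), fun η => ?_⟩
  · simp only [hA, hB, Pi.mul_apply]
  · simp only [add_apply, smul_apply, hA, hB,
      smul_eq_mul, Pi.zero_apply, mul_zero, add_zero]
    rw [← mul_assoc, Finset.mul_sum]
    refine Finset.sum_congr rfl fun l _ => ?_
    ring

/-- A nondegenerate zero of a system of exponential sums persists under small perturbations of
the coefficients. -/
theorem eventually_exists_zero_expSum {d : ℕ} {κ : Type*} [Fintype κ] (w : κ → Fin d → ℝ)
    (b₀ : Fin d → κ → ℝ) (α : Fin d → ℝ)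
    (h₀ : ∀ i, ∑ j, b₀ i j * Real.exp (∑ l, α l * w j l) = 0)
    (hdet : (expJacobian w b₀ α).det ≠ 0) :
    ∀ᶠ b in 𝓝 b₀, ∃ y : Fin d → ℝ, (∀ l, |y l - α l| < 1) ∧
      (∀ i, ∑ j, b i j * Real.exp (∑ l, y l * w j l) = 0) ∧ (expJacobian w b y).det ≠ 0 := by
  choose L hL hL' using fun i j => hasStrictFDerivAt_expTerm w i j (b₀, α)
  let Ψ : (Fin d → κ → ℝ) × (Fin d → ℝ) → (Fin d → κ → ℝ) × (Fin d → ℝ) :=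
    fun p => (p.1, fun i => ∑ j, p.1 i j * Real.exp (∑ l, p.2 l * w j l))
  have hΨ : HasStrictFDerivAt Ψ ((ContinuousLinearMap.fst ℝ _ _).prod
      (ContinuousLinearMap.pi fun i => ∑ j, L i j)) (b₀, α) := by
    refine HasStrictFDerivAt.prodMk hasStrictFDerivAt_fst ?_
    rw [hasStrictFDerivAt_pi']
    intro i
    have := HasStrictFDerivAt.fun_sum (u := Finset.univ) (fun j _ => hL i j)
    simpa using this
  -- The derivative is block triangular, with diagonal blocks the identity and the invertible
  -- logarithmic Jacobian. Hence `Ψ` maps neighbourhoods to neighbourhoods, which gives existence of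
  -- the perturbed zero.
  have hsurj : ((ContinuousLinearMap.fst ℝ _ _).prod
      (ContinuousLinearMap.pi fun i => ∑ j, L i j)).range = ⊤ := by
    rw [LinearMap.range_eq_top]
    rintro ⟨β, γ⟩
    have hu : IsUnit (expJacobian w b₀ α) := by
      rw [Matrix.isUnit_iff_isUnit_det]; exact hdet.isUnit
    obtain ⟨η, hη⟩ := (Matrix.mulVec_surjective_iff_isUnit.2 hu)
      (fun i => γ i - ∑ j, L i j (β, 0))
    refine ⟨(β, η), ?_⟩
    have hsplit : ((β, η) : (Fin d → κ → ℝ) × (Fin d → ℝ)) = (β, 0) + (0, η) := by simp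
    refine Prod.ext rfl ?_
    funext i
    have h1 := congrFun hη i
    have h2 : ∑ j, L i j (0, η) = (expJacobian w b₀ α).mulVec η i := by
      simp only [hL', Matrix.mulVec, dotProduct, expJacobian, Matrix.of_apply, Finset.sum_mul]
      rw [Finset.sum_comm]
    have h3 : ∑ j, L i j (β, η) = γ i := by
      rw [hsplit]
      simp only [map_add, Finset.sum_add_distrib]
      rw [h2, h1]; ring
    simpa using h3
  have hmap := hΨ.map_nhds_eq_of_surj hsurj
  have hW : {p : (Fin d → κ → ℝ) × (Fin d → ℝ) | (∀ l, |p.2 l - α l| < 1) ∧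
      (expJacobian w p.1 p.2).det ≠ 0} ∈ 𝓝 (b₀, α) := by
    apply IsOpen.mem_nhds
    · apply IsOpen.inter
      · have : {p : (Fin d → κ → ℝ) × (Fin d → ℝ) | ∀ l, |p.2 l - α l| < 1} =
            ⋂ l, {p | |p.2 l - α l| < 1} := by ext; simp
        change IsOpen {p : (Fin d → κ → ℝ) × (Fin d → ℝ) | ∀ l, |p.2 l - α l| < 1}
        rw [this]
        refine isOpen_iInter_of_finite fun l => isOpen_lt ?_ continuous_const
        fun_prop
      · exact isOpen_ne_fun (continuous_det_expJacobian w) continuous_const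
    · exact ⟨fun l => by simp, hdet⟩
  have himg := Filter.image_mem_map (m := Ψ) hW
  rw [hmap] at himg
  have hΨ0 : Ψ (b₀, α) = (b₀, 0) := Prod.ext rfl (funext h₀)
  rw [hΨ0] at himg
  have hcont : Tendsto (fun b : Fin d → κ → ℝ => (b, (0 : Fin d → ℝ))) (𝓝 b₀) (𝓝 (b₀, 0)) :=
    Continuous.tendsto (by fun_prop) b₀
  filter_upwards [hcont himg] with b hb
  obtain ⟨⟨b', y⟩, ⟨hy, hd⟩, hby⟩ := hb
  have h1 : b' = b := congrArg Prod.fst hby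
  subst h1
  exact ⟨y, hy, fun i => congrFun (congrArg Prod.snd hby) i, hd⟩

/-! ### Viro's method for polynomial systems -/

theorem encard_le_Xi {d k : ℕ} (f : Fin d → MvPolynomial (Fin d) ℝ)
    (hf : (systemSupport f).card ≤ d + k + 1) : (nondegPosSolutions f).encard ≤ Xi d k :=
  le_iSup₂ (f := fun (f : Fin d → MvPolynomial (Fin d) ℝ)
    (_ : (systemSupport f).card ≤ d + k + 1) => (nondegPosSolutions f).encard) f hf

theorem card_le_Xi {d k : ℕ} {σ : Type*} [Fintype σ] (f : Fin d → MvPolynomial (Fin d) ℝ)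
    (hf : (systemSupport f).card ≤ d + k + 1) (x : σ → Fin d → ℝ) (hx : Function.Injective x)
    (hsol : ∀ s, x s ∈ nondegPosSolutions f) : (Fintype.card σ : ℕ∞) ≤ Xi d k := by
  refine le_trans ?_ (encard_le_Xi f hf)
  have h : Set.range x ⊆ nondegPosSolutions f := Set.range_subset_iff.2 hsol
  refine le_trans ?_ (Set.encard_le_encard h)
  rw [← ENat.card_eq_coe_fintype_card]
  exact hx.encard_range

theorem eval_monomial_exp {d : ℕ} (z : Fin d → ℝ) (w : Fin d → ℕ) (a : ℝ) :
    MvPolynomial.eval (fun l => Real.exp (z l))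
      (MvPolynomial.monomial (Finsupp.equivFunOnFinite.symm w) a) =
      a * Real.exp (∑ l, z l * w l) := by
  rw [MvPolynomial.eval_monomial, Finsupp.prod_fintype _ _ (fun i => pow_zero _), Real.exp_sum]
  congr 1
  refine Finset.prod_congr rfl fun l _ => ?_
  rw [mul_comm, Real.exp_nat_mul]
  rfl

/-- Logarithmic derivatives have monomials as eigenvectors; this links the Jacobian of the
polynomials to `expJacobian`. -/
theorem eval_pderiv_monomial_mul {d : ℕ} (x : Fin d → ℝ) (s : Fin d →₀ ℕ) (a : ℝ) (l : Fin d) :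
    MvPolynomial.eval x (MvPolynomial.pderiv l (MvPolynomial.monomial s a)) * x l =
      s l * MvPolynomial.eval x (MvPolynomial.monomial s a) := by
  have h := congrArg (MvPolynomial.eval x) (MvPolynomial.X_mul_pderiv_monomial (i := l) (m := s)
    (r := a))
  rw [map_mul, MvPolynomial.eval_X, map_nsmul, nsmul_eq_mul] at h
  rw [mul_comm, h]

/-- Viro's method: given a polynomial system with coefficients `C i j * exp (-T * h i j)` whose
tropical limits at the slopes `u s` have nondegenerate positive zeros, there are at least as many
nondegenerate positive solutions as slopes. -/
theorem card_le_Xi_of_tropical {d k : ℕ} {ι σ : Type*} [DecidableEq ι] [Fintype σ]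
    (J : Finset ι) (hJ : J.card ≤ d + k + 1) (w : ι → Fin d → ℕ) (h C : Fin d → ι → ℝ)
    (u : σ → Fin d → ℝ) (hu : Function.Injective u) (c : σ → Fin d → ℝ)
    (hpos : ∀ s i, ∀ j ∈ J, 0 ≤ h i j + ∑ l, u s l * w j l + c s i)
    (α : σ → Fin d → ℝ)
    (hα : ∀ s i, ∑ j ∈ J with h i j + ∑ l, u s l * w j l + c s i = 0,
      C i j * Real.exp (∑ l, α s l * w j l) = 0)
    (hdet : ∀ s, (Matrix.of fun i m : Fin d =>
      ∑ j ∈ J with h i j + ∑ l, u s l * w j l + c s i = 0,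
        C i j * w j m * Real.exp (∑ l, α s l * w j l)).det ≠ 0) :
    (Fintype.card σ : ℕ∞) ≤ Xi d k := by
  classical
  -- Under `x = exp (-T * u s + y)` the term `j` decays like `exp (-T * δ s i j)` up to a common
  -- factor, so only the terms with `δ = 0` survive as `T` grows.
  let δ : σ → Fin d → ι → ℝ := fun s i j => h i j + ∑ l, u s l * w j l + c s i
  let W : J → Fin d → ℝ := fun j l => w j l
  let B : σ → ℝ → Fin d → J → ℝ := fun s T i j => C i j * Real.exp (-T * δ s i j)
  let B₀ : σ → Fin d → J → ℝ := fun s i j => if δ s i j = 0 then C i j else 0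
  have hlim : ∀ s, Tendsto (B s) atTop (𝓝 (B₀ s)) := by
    intro s
    rw [tendsto_pi_nhds]; intro i
    rw [tendsto_pi_nhds]; intro j
    by_cases hδ : δ s i j = 0
    · simp only [B, B₀, hδ, if_true, mul_zero, Real.exp_zero, mul_one]
      exact tendsto_const_nhds
    · simp only [B, B₀, hδ, if_false]
      have hp : 0 < δ s i j := lt_of_le_of_ne (hpos s i j j.2) (Ne.symm hδ)
      have h1 : Tendsto (fun T : ℝ => -T * δ s i j) atTop atBot := by
        have := (tendsto_id (α := ℝ) (x := atTop)).atTop_mul_const hp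
        refine (tendsto_neg_atTop_atBot.comp this).congr fun T => ?_
        simp
      simpa using (Real.tendsto_exp_atBot.comp h1).const_mul (C i j)
  have hev : ∀ᶠ T in atTop, ∀ s, ∃ y : Fin d → ℝ, (∀ l, |y l - α s l| < 1) ∧
      (∀ i, ∑ j, B s T i j * Real.exp (∑ l, y l * W j l) = 0) ∧
      (expJacobian W (B s T) y).det ≠ 0 := by
    rw [eventually_all]
    intro s
    refine (hlim s).eventually (eventually_exists_zero_expSum W (B₀ s) (α s) ?_ ?_)
    · intro i
      rw [← hα s i, Finset.sum_filter, ← Finset.sum_coe_sort J]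
      refine Finset.sum_congr rfl fun j _ => ?_
      simp only [B₀, δ, W]
      split_ifs <;> simp
    · convert hdet s using 2
      ext i m
      simp only [expJacobian, Matrix.of_apply]
      rw [Finset.sum_filter, ← Finset.sum_coe_sort J]
      refine Finset.sum_congr rfl fun j _ => ?_
      simp only [B₀, δ, W]
      split_ifs <;> simp
  -- The zeros `y` stay within `1` of `α`, which accounts for the `2`; the gap between distinct
  -- slopes is magnified by `T`, so different slopes give different solutions.
  have hsep : ∀ᶠ T in atTop, ∀ s s' : σ, ∀ l, u s l ≠ u s' l →
      |α s l - α s' l| + 2 < T * |u s l - u s' l| := by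
    simp only [eventually_all]
    intro s s' l hne
    have : 0 < |u s l - u s' l| := abs_pos.2 (sub_ne_zero.2 hne)
    exact ((tendsto_id (α := ℝ) (x := atTop)).atTop_mul_const this).eventually_gt_atTop _
  obtain ⟨T, hT, hTsep, hT0⟩ := (hev.and (hsep.and (eventually_gt_atTop 0))).exists
  choose y hyα hy hyd using hT
  let mon : ι → Fin d →₀ ℕ := fun j => Finsupp.equivFunOnFinite.symm (w j)
  let f : Fin d → MvPolynomial (Fin d) ℝ := fun i =>
    ∑ j ∈ J, MvPolynomial.monomial (mon j) (C i j * Real.exp (-T * h i j))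
  let z : σ → Fin d → ℝ := fun s l => -T * u s l + y s l
  have hexp : ∀ s i j, C i j * Real.exp (-T * h i j) * Real.exp (∑ l, z s l * w j l) =
      Real.exp (T * c s i) * (C i j * Real.exp (-T * δ s i j) *
        Real.exp (∑ l, y s l * w j l)) := by
    intro s i j
    have : Real.exp (-T * h i j) * Real.exp (∑ l, z s l * w j l) =
        Real.exp (T * c s i) * (Real.exp (-T * δ s i j) * Real.exp (∑ l, y s l * w j l)) := by
      simp only [← Real.exp_add]
      congr 1
      simp only [z, δ, add_mul, mul_add, Finset.sum_add_distrib, Finset.mul_sum]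
      simp only [mul_assoc]
      ring
    rw [mul_assoc, this]; ring
  refine card_le_Xi f ?_ (fun s l => Real.exp (z s l)) ?_ ?_
  · refine le_trans (Finset.card_le_card (t := J.image mon) ?_) (Finset.card_image_le.trans hJ)
    intro e he
    simp only [systemSupport, Finset.mem_biUnion, Finset.mem_univ, true_and] at he
    obtain ⟨i, hi⟩ := he
    obtain ⟨j, hj, hje⟩ := Finset.mem_biUnion.1 (MvPolynomial.support_sum hi)
    have := MvPolynomial.support_monomial_subset hje
    exact Finset.mem_image.2 ⟨j, hj, (Finset.mem_singleton.1 this).symm⟩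
  · intro s s' hss
    apply hu
    funext l
    by_contra hne
    have h1 : z s l = z s' l := Real.exp_injective (congrFun hss l)
    have h2 : T * (u s l - u s' l) = y s l - y s' l := by simp only [z] at h1; linarith
    have h3 := hTsep s s' l hne
    rw [← abs_of_pos hT0, ← abs_mul, h2] at h3
    have h4 := hyα s l
    have h5 := hyα s' l
    have h6 : |y s l - y s' l| ≤ |α s l - α s' l| + 2 := by
      rw [abs_lt] at h4 h5
      rw [abs_le]
      constructor
      · linarith [neg_abs_le (α s l - α s' l)]
      · linarith [le_abs_self (α s l - α s' l)]
    linarith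
  · intro s
    refine ⟨fun l => Real.exp_pos _, fun i => ?_, ?_⟩
    · simp only [f, map_sum, mon, eval_monomial_exp, hexp]
      rw [← Finset.mul_sum, ← Finset.sum_coe_sort J]
      have := hy s i
      simp only [B, W] at this
      rw [this, mul_zero]
    · rw [Matrix.isUnit_iff_isUnit_det]
      apply IsUnit.mk0
      intro h0
      -- Chain rule for `x = exp z`: the two Jacobians differ by invertible diagonal scalings of
      -- rows and columns.
      have hM : systemJacobian f (fun l => Real.exp (z s l)) *
          Matrix.diagonal (fun l => Real.exp (z s l)) =
          Matrix.diagonal (fun i => Real.exp (T * c s i)) * expJacobian W (B s T) (y s) := by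
        ext i m
        rw [Matrix.mul_diagonal, Matrix.diagonal_mul]
        simp only [systemJacobian, expJacobian, Matrix.of_apply, f, map_sum, Finset.sum_mul]
        simp only [eval_pderiv_monomial_mul, mon, eval_monomial_exp, hexp]
        rw [Finset.mul_sum, ← Finset.sum_coe_sort J]
        refine Finset.sum_congr rfl fun j _ => ?_
        simp only [B, W, Finsupp.equivFunOnFinite_symm_apply_apply]
        ring
      have hD := congrArg Matrix.det hM
      rw [Matrix.det_mul, h0, zero_mul, Matrix.det_mul, Matrix.det_diagonal] at hD
      refine hyd s ?_
      rcases mul_eq_zero.1 hD.symm with h' | h'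
      · exact absurd h' (Finset.prod_ne_zero_iff.2 fun i _ => (Real.exp_pos _).ne')
      · exact h'

/-! ### Adjoining a variable -/

/-- The system obtained from `f` by adding a new variable `Y` (the one with index `0`) and the
equation `X ^ m * P(Y) = 0`. -/
noncomputable def extendSystem {d : ℕ} (f : Fin d → MvPolynomial (Fin d) ℝ) (m : Fin d →₀ ℕ)
    (P : Polynomial ℝ) : Fin (d + 1) → MvPolynomial (Fin (d + 1)) ℝ :=
  Fin.cons (MvPolynomial.rename Fin.succ (MvPolynomial.monomial m 1) *
    Polynomial.aeval (MvPolynomial.X 0) P) fun i => MvPolynomial.rename Fin.succ (f i)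

/-- Only the positive powers of the new variable create monomials; the constant term of `P`
contributes `X ^ m` itself. -/
theorem card_systemSupport_extendSystem_le {d : ℕ} (f : Fin d → MvPolynomial (Fin d) ℝ)
    (m : Fin d →₀ ℕ) (P : Polynomial ℝ) :
    (systemSupport (extendSystem f m P)).card ≤
      (insert m (systemSupport f)).card + P.natDegree := by
  classical
  let m' : Fin (d + 1) →₀ ℕ := m.mapDomain Fin.succ
  have hsub : systemSupport (extendSystem f m P) ⊆
      (insert m (systemSupport f)).image (Finsupp.mapDomain Fin.succ) ∪
        (Finset.Icc 1 P.natDegree).image (fun e => m' + Finsupp.single 0 e) := by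
    intro e he
    simp only [systemSupport, Finset.mem_biUnion, Finset.mem_univ, true_and] at he
    obtain ⟨i, hi⟩ := he
    revert hi
    refine Fin.cases (fun hi => ?_) (fun i hi => ?_) i
    · have heq : extendSystem f m P 0 = ∑ e ∈ Finset.range (P.natDegree + 1),
          MvPolynomial.monomial (m' + Finsupp.single 0 e) (P.coeff e) := by
        simp only [extendSystem, Fin.cons_zero, MvPolynomial.rename_monomial]
        rw [Polynomial.aeval_eq_sum_range, Finset.mul_sum]
        refine Finset.sum_congr rfl fun e _ => ?_
        rw [MvPolynomial.X_pow_eq_monomial, MvPolynomial.smul_monomial,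
          MvPolynomial.monomial_mul]
        simp [m']
      rw [heq] at hi
      obtain ⟨a, ha, hae⟩ := Finset.mem_biUnion.1 (MvPolynomial.support_sum hi)
      have h1 := Finset.mem_singleton.1 (MvPolynomial.support_monomial_subset hae)
      rw [Finset.mem_union, Finset.mem_image, Finset.mem_image]
      rcases Nat.eq_zero_or_pos a with h0 | h0
      · left
        exact ⟨m, Finset.mem_insert_self _ _, by rw [h1, h0]; simp [m']⟩
      · right
        exact ⟨a, Finset.mem_Icc.2 ⟨h0, Nat.lt_succ_iff.1 (Finset.mem_range.1 ha)⟩, h1.symm⟩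
    · simp only [extendSystem, Fin.cons_succ] at hi
      rw [MvPolynomial.support_rename_of_injective (Fin.succ_injective d)] at hi
      obtain ⟨a, ha, hae⟩ := Finset.mem_image.1 hi
      refine Finset.mem_union_left _ (Finset.mem_image.2 ⟨a, Finset.mem_insert_of_mem ?_, hae⟩)
      exact Finset.mem_biUnion.2 ⟨i, Finset.mem_univ _, ha⟩
  refine (Finset.card_le_card hsub).trans ((Finset.card_union_le _ _).trans ?_)
  refine Nat.add_le_add Finset.card_image_le (Finset.card_image_le.trans ?_)
  simp

theorem pderiv_zero_rename_succ {d : ℕ} (p : MvPolynomial (Fin d) ℝ) :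
    MvPolynomial.pderiv 0 (MvPolynomial.rename Fin.succ p) = 0 := by
  classical
  apply MvPolynomial.pderiv_eq_zero_of_notMem_vars
  intro h
  have := MvPolynomial.vars_rename _ _ h
  obtain ⟨a, -, ha⟩ := Finset.mem_image.1 this
  exact Fin.succ_ne_zero a ha

/-- At a root of `P` the first row of the Jacobian vanishes off the diagonal, so the determinant is
the old one times `x ^ m * P' y`. -/
theorem cons_mem_nondegPosSolutions_extendSystem {d : ℕ} {f : Fin d → MvPolynomial (Fin d) ℝ}
    {x : Fin d → ℝ} (hx : x ∈ nondegPosSolutions f) (m : Fin d →₀ ℕ) {P : Polynomial ℝ} {y : ℝ}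
    (hy : 0 < y) (hP : P.eval y = 0) (hP' : P.derivative.eval y ≠ 0) :
    (Fin.cons y x : Fin (d + 1) → ℝ) ∈ nondegPosSolutions (extendSystem f m P) := by
  obtain ⟨hpos, hsol, hjac⟩ := hx
  have hev : ∀ p : MvPolynomial (Fin d) ℝ,
      MvPolynomial.eval (Fin.cons y x : Fin (d + 1) → ℝ) (MvPolynomial.rename Fin.succ p) =
        MvPolynomial.eval x p := by
    intro p
    rw [MvPolynomial.eval_rename]
    rfl
  have haev : ∀ Q : Polynomial ℝ, MvPolynomial.eval (Fin.cons y x : Fin (d + 1) → ℝ)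
      (Polynomial.aeval (MvPolynomial.X 0) Q) = Q.eval y := by
    intro Q
    have := Polynomial.map_aeval_eq_aeval_map (S := MvPolynomial (Fin (d + 1)) ℝ) (U := ℝ)
      (φ := RingHom.id ℝ) (ψ := MvPolynomial.eval (Fin.cons y x : Fin (d + 1) → ℝ))
      (by ext r; simp) Q (MvPolynomial.X 0)
    rw [this]
    simp
  refine ⟨fun j => ?_, fun i => ?_, ?_⟩
  · refine Fin.cases ?_ (fun j => ?_) j
    · simpa using hy
    · simpa using hpos j
  · refine Fin.cases ?_ (fun i => ?_) i
    · simp only [extendSystem, Fin.cons_zero, map_mul, haev, hP, mul_zero]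
    · simp only [extendSystem, Fin.cons_succ, hev, hsol]
  · rw [Matrix.isUnit_iff_isUnit_det] at hjac ⊢
    have hmon : MvPolynomial.eval x (MvPolynomial.monomial m 1) ≠ 0 := by
      rw [MvPolynomial.eval_monomial, one_mul]
      exact Finset.prod_ne_zero_iff.2 fun i _ => pow_ne_zero _ (hpos i).ne'
    have h00 : systemJacobian (extendSystem f m P) (Fin.cons y x) 0 0 =
        MvPolynomial.eval x (MvPolynomial.monomial m 1) * P.derivative.eval y := by
      simp only [systemJacobian, Matrix.of_apply, extendSystem, Fin.cons_zero]
      rw [Derivation.leibniz, pderiv_zero_rename_succ, Derivation.map_aeval]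
      simp [hev, haev]
    have h0s : ∀ j : Fin d, systemJacobian (extendSystem f m P) (Fin.cons y x) 0 j.succ = 0 := by
      intro j
      simp only [systemJacobian, Matrix.of_apply, extendSystem, Fin.cons_zero]
      rw [Derivation.leibniz, Derivation.map_aeval, MvPolynomial.pderiv_X_of_ne
        (Fin.succ_ne_zero j).symm]
      simp [haev, hP]
    have hss : (systemJacobian (extendSystem f m P) (Fin.cons y x)).submatrix Fin.succ
        (Fin.succAbove 0) = systemJacobian f x := by
      ext i j
      simp only [systemJacobian, Matrix.of_apply, Matrix.submatrix_apply, extendSystem,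
        Fin.cons_succ, Fin.succAbove_zero]
      rw [MvPolynomial.pderiv_rename (Fin.succ_injective d), hev]
    rw [Matrix.det_succ_row_zero, Fin.sum_univ_succ, hss, h00]
    simp only [h0s, mul_zero, zero_mul, Finset.sum_const_zero, add_zero, Fin.val_zero, pow_zero,
      one_mul]
    exact (IsUnit.mk0 _ (mul_ne_zero hmon hP')).mul hjac

theorem add_one_mul_Xi_le (d k r : ℕ) : ((r + 1 : ℕ) : ℕ∞) * Xi d k ≤ Xi (d + 1) (k + r) := by
  classical
  conv_lhs => rw [Xi]
  simp only [ENat.mul_iSup]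
  refine iSup₂_le fun f hf => ?_
  -- Reusing a monomial of `f` means that the new equation adds only `r + 1` monomials.
  obtain ⟨m, hm⟩ : ∃ m, (insert m (systemSupport f)).card ≤ d + k + 1 := by
    rcases (systemSupport f).eq_empty_or_nonempty with h | ⟨m, hm⟩
    · exact ⟨0, by rw [h]; simp⟩
    · exact ⟨m, by rwa [Finset.insert_eq_of_mem hm]⟩
  let P : Polynomial ℝ := ∏ a : Fin (r + 1), (Polynomial.X - Polynomial.C ((a : ℝ) + 1))
  have hinj : Function.Injective fun a : Fin (r + 1) => ((a : ℝ) + 1) := by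
    intro a b hab
    have : (a : ℝ) = b := by simpa using hab
    exact Fin.ext (by exact_mod_cast this)
  have hsep : P.Separable := Polynomial.separable_prod_X_sub_C_iff.2 hinj
  have hroot : ∀ a : Fin (r + 1), P.eval ((a : ℝ) + 1) = 0 := by
    intro a
    rw [Polynomial.eval_prod]
    exact Finset.prod_eq_zero (Finset.mem_univ a) (by simp)
  have hdeg : P.natDegree = r + 1 := by
    rw [Polynomial.natDegree_prod_of_monic _ _ fun a _ => Polynomial.monic_X_sub_C _]
    simp only [Polynomial.natDegree_X_sub_C]
    simp
  refine le_trans ?_ (encard_le_Xi (extendSystem f m P) ?_)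
  · have hsub : (fun p : ℝ × (Fin d → ℝ) => (Fin.cons p.1 p.2 : Fin (d + 1) → ℝ)) ''
        (Set.range (fun a : Fin (r + 1) => ((a : ℝ) + 1)) ×ˢ nondegPosSolutions f) ⊆
        nondegPosSolutions (extendSystem f m P) := by
      rintro _ ⟨⟨y, x⟩, ⟨⟨a, rfl⟩, hx⟩, rfl⟩
      refine cons_mem_nondegPosSolutions_extendSystem hx m (by positivity) (hroot a) ?_
      have := hsep.aeval_derivative_ne_zero (x := (a : ℝ) + 1) (by simpa using hroot a)
      simpa using this
    refine le_trans ?_ (Set.encard_le_encard hsub)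
    rw [Function.Injective.encard_image, Set.encard_prod, ← Set.image_univ, hinj.encard_image]
    · simp
    · rintro ⟨y, x⟩ ⟨y', x'⟩ h
      have h' := Fin.cons_inj.1 h
      exact Prod.ext h'.1 h'.2
  · have := card_systemSupport_extendSystem_le f m P
    omega

theorem one_le_Xi_zero_zero : 1 ≤ Xi 0 0 := by
  have := card_le_Xi (k := 0) (σ := Unit) (fun i : Fin 0 => i.elim0) (by simp [systemSupport])
    (fun _ i => i.elim0) (fun _ _ _ => rfl)
    (fun _ => ⟨fun i => i.elim0, fun i => i.elim0, by
      rw [Matrix.isUnit_iff_isUnit_det, Matrix.det_isEmpty]; exact isUnit_one⟩)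
  simpa using this

theorem Xi_le_Xi_succ (d k : ℕ) : Xi d k ≤ Xi (d + 1) k := by
  simpa using add_one_mul_Xi_le d k 0

theorem one_le_Xi_zero (d : ℕ) : 1 ≤ Xi d 0 := by
  induction d with
  | zero => exact one_le_Xi_zero_zero
  | succ d ih => exact ih.trans (Xi_le_Xi_succ d 0)

theorem add_one_le_Xi_one (k : ℕ) : ((k + 1 : ℕ) : ℕ∞) ≤ Xi 1 k := by
  have h := add_one_mul_Xi_le 0 0 k
  rw [zero_add, zero_add] at h
  exact le_trans (by simpa using mul_le_mul_right one_le_Xi_zero_zero ((k + 1 : ℕ) : ℕ∞)) h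

theorem natCast_mul_le_Xi {d k N : ℕ} (h : (N : ℕ∞) ≤ Xi d k) (r : ℕ) :
    (((r + 1) * N : ℕ) : ℕ∞) ≤ Xi (d + 1) (k + r) := by
  refine le_trans ?_ (add_one_mul_Xi_le d k r)
  rw [Nat.cast_mul]
  gcongr

/-! ### Two polynomials in six monomials with eight positive solutions -/

namespace HexanomialPair

/-- Exponents of six monomials in two variables. -/
def expo : Fin 6 → Fin 2 → ℕ := ![![0, 2], ![1, 0], ![2, 0], ![1, 3], ![0, 1], ![3, 0]]

/-- Coefficients of two polynomials in these monomials. -/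
def coef : Fin 2 → Fin 6 → ℤ := ![![-1, -1, 0, 1, 1, 0], ![-1, -1, 1, 0, 1, -1]]

/-- Heights of the coefficients; those of vanishing coefficients are irrelevant but large. -/
def height : Fin 2 → Fin 6 → ℤ := ![![5, 19, 100, 4, 10, 100], ![9, 6, 7, 100, 4, 9]]

/-- Eight transversal intersection points of the two tropical curves. -/
def point : Fin 8 → Fin 2 → ℤ :=
  ![![6, -5], ![-1, 2], ![-2, 3], ![-1, 5], ![3, 5], ![-2, 5], ![-1, 8], ![-2, 7]]

/-- Minus the values of the two tropical polynomials at the points `point`. -/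
def offset : Fin 8 → Fin 2 → ℤ :=
  ![![5, 1], ![-9, -5], ![-11, -3], ![-15, -5], ![-15, -9], ![-15, -3], ![-18, -5], ![-17, -3]]

/-- The excess of the term `j` over the minimum at the point `s`. -/
def excess (s : Fin 8) (i : Fin 2) (j : Fin 6) : ℤ :=
  height i j + (point s 0 * expo j 0 + point s 1 * expo j 1) + offset s i

theorem excess_nonneg : ∀ s i j, 0 ≤ excess s i j := by decide +kernel

theorem sum_coef_eq_zero : ∀ s i, ∑ j with excess s i j = 0, coef i j = 0 := by decide +kernel

theorem det_ne_zero : ∀ s,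
    (∑ j with excess s 0 j = 0, coef 0 j * expo j 0) *
      (∑ j with excess s 1 j = 0, coef 1 j * expo j 1) -
    (∑ j with excess s 0 j = 0, coef 0 j * expo j 1) *
      (∑ j with excess s 1 j = 0, coef 1 j * expo j 0) ≠ 0 := by decide +kernel

theorem point_injective : Function.Injective point := by decide +kernel

/-- A finite check: at each of the eight tropical intersection points both truncations vanish at
`(1, 1)`, that is at `α = 0`, with nonzero logarithmic Jacobian. -/
theorem eight_le_Xi : 8 ≤ Xi 2 3 := by
  have hδ : ∀ s i j, (height i j : ℝ) + ∑ l, (point s l : ℝ) * expo j l + offset s i =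
      ((excess s i j : ℤ) : ℝ) := by
    intro s i j
    simp [excess, Fin.sum_univ_two]
  have h := card_le_Xi_of_tropical (d := 2) (k := 3) (σ := Fin 8) Finset.univ (by simp) expo
    (fun i j => (height i j : ℝ)) (fun i j => (coef i j : ℝ)) (fun s l => (point s l : ℝ))
    (fun s s' hs => point_injective (funext fun l => Int.cast_injective (α := ℝ) (congrFun hs l)))
    (fun s i => (offset s i : ℝ)) (fun s i j _ => by
      rw [hδ]; exact_mod_cast excess_nonneg s i j)
    (fun _ _ => 0)
    (fun s i => by
      simp only [hδ, Int.cast_eq_zero, zero_mul, Finset.sum_const_zero, Real.exp_zero, mul_one]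
      exact_mod_cast sum_coef_eq_zero s i)
    (fun s => by
      simp only [hδ, Int.cast_eq_zero, zero_mul, Finset.sum_const_zero, Real.exp_zero, mul_one,
        Matrix.det_fin_two, Matrix.of_apply]
      exact_mod_cast det_ne_zero s)
  simpa using h

end HexanomialPair

/-! ### Positively decorated simplices -/

/-- `S` is a simplex with respect to the points `w`: every function on `S` is the restriction of
an affine function. -/
def AffinelyInterpolates {ι : Type*} {d : ℕ} (w : ι → Fin d → ℝ) (S : Finset ι) : Prop :=
  ∀ g : ι → ℝ, ∃ (y : Fin d → ℝ) (b : ℝ), ∀ j ∈ S, ∑ l, y l * w j l + b = g j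

/-- `S` is a lower face of the lifting of the points `w j`, `j ∈ J`, by the heights `h j`. -/
def IsLowerFace {ι : Type*} {d : ℕ} (w : ι → Fin d → ℝ) (h : ι → ℝ) (J S : Finset ι) : Prop :=
  ∃ (y : Fin d → ℝ) (b : ℝ), ∀ j ∈ J,
    0 ≤ h j + ∑ l, y l * w j l + b ∧ (h j + ∑ l, y l * w j l + b = 0 ↔ j ∈ S)

/-- The columns with index in `S` of the matrix `C` have a unique linear relation up to scalars,
and it is positive. -/
def IsPositivelyDecorated {ι : Type*} {d : ℕ} (C : Fin d → ι → ℝ) (S : Finset ι) : Prop :=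
  ∃ c : ι → ℝ, (∀ j ∈ S, 0 < c j) ∧ (∀ i, ∑ j ∈ S, C i j * c j = 0) ∧
    ∀ μ : ι → ℝ, (∀ i, ∑ j ∈ S, C i j * μ j = 0) → ∃ κ : ℝ, ∀ j ∈ S, μ j = κ * c j

/-- Affine functions and functions on `S` both form spaces of dimension `d + 1`, so the surjective
restriction map is injective. -/
theorem AffinelyInterpolates.eq_zero {ι : Type*} {d : ℕ} {w : ι → Fin d → ℝ} {S : Finset ι}
    (hS : AffinelyInterpolates w S) (hcard : S.card = d + 1) {y : Fin d → ℝ} {b : ℝ}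
    (h : ∀ j ∈ S, ∑ l, y l * w j l + b = 0) : y = 0 := by
  classical
  let A : (Fin d → ℝ) × ℝ →ₗ[ℝ] (S → ℝ) :=
    { toFun := fun p j => ∑ l, p.1 l * w j l + p.2
      map_add' := by
        intro p q
        funext j
        simp only [Prod.fst_add, Prod.snd_add, Pi.add_apply, add_mul, Finset.sum_add_distrib]
        ring
      map_smul' := by
        intro r p
        funext j
        simp only [Prod.smul_fst, Prod.smul_snd, Pi.smul_apply, smul_eq_mul, RingHom.id_apply,
          mul_add, Finset.mul_sum, mul_assoc] }
  have hdim : Module.finrank ℝ ((Fin d → ℝ) × ℝ) = Module.finrank ℝ (S → ℝ) := by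
    simp [hcard]
  have hsurj : Function.Surjective A := by
    intro g
    obtain ⟨y, b, hyb⟩ := hS fun j => if hj : j ∈ S then g ⟨j, hj⟩ else 0
    refine ⟨(y, b), funext fun j => ?_⟩
    have h1 := hyb j j.2
    rw [dif_pos j.2] at h1
    exact h1
  have hinj := (LinearMap.injective_iff_surjective_of_finrank_eq_finrank hdim).2 hsurj
  have h0 : A (y, b) = A 0 := by
    rw [map_zero]
    exact funext fun j => h j j.2
  exact congrArg Prod.fst (hinj h0)

/-- At the slope of `S` the limit system involves only the monomials in `S`. Interpolating the
logarithms of the positive kernel vector by an affine function gives a point where these monomials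
equal that vector up to the scalar `exp (-β S)`. -/
theorem card_le_Xi_of_decorated {ι : Type*} [DecidableEq ι] {d k : ℕ} (J : Finset ι)
    (hJ : J.card ≤ d + k + 1) (w : ι → Fin d → ℕ) (h : ι → ℝ) (C : Fin d → ι → ℝ)
    (Γ : Finset (Finset ι)) (hsub : ∀ S ∈ Γ, S ⊆ J) (hcard : ∀ S ∈ Γ, S.card = d + 1)
    (hface : ∀ S ∈ Γ, IsLowerFace (fun j l => (w j l : ℝ)) h J S)
    (hint : ∀ S ∈ Γ, AffinelyInterpolates (fun j l => (w j l : ℝ)) S)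
    (hdec : ∀ S ∈ Γ, IsPositivelyDecorated C S) :
    (Γ.card : ℕ∞) ≤ Xi d k := by
  classical
  choose u b hub using fun S : Γ => hface S S.2
  choose c hcpos hcker hcuniq using fun S : Γ => hdec S S.2
  choose α β hαβ using fun S : Γ => hint S S.2 fun j => Real.log (c S j)
  have hfilter : ∀ (S : Γ) (g : ι → ℝ),
      ∑ j ∈ J with h j + ∑ l, u S l * (w j l : ℝ) + b S = 0, g j = ∑ j ∈ (S : Finset ι), g j := by
    intro S g
    congr 1
    ext j
    rw [Finset.mem_filter]
    constructor
    · rintro ⟨hj, h0⟩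
      exact (hub S j hj).2.1 h0
    · intro hj
      have hjJ := hsub S S.2 hj
      exact ⟨hjJ, (hub S j hjJ).2.2 hj⟩
  have hexp : ∀ (S : Γ), ∀ j ∈ (S : Finset ι),
      Real.exp (∑ l, α S l * (w j l : ℝ)) = Real.exp (-β S) * c S j := by
    intro S j hj
    have h1 : ∑ l, α S l * (w j l : ℝ) = -β S + Real.log (c S j) := by
      have := hαβ S j hj
      linarith
    rw [h1, Real.exp_add, Real.exp_log (hcpos S j hj)]
  have hne : ∀ S : Γ, ∃ j, j ∈ (S : Finset ι) := fun S =>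
    Finset.card_pos.1 (by rw [hcard S S.2]; exact Nat.succ_pos d)
  have hle : ∀ S S' : Γ, u S = u S' → b S ≤ b S' := by
    intro S S' huu
    obtain ⟨j, hj⟩ := hne S
    have hjJ := hsub S S.2 hj
    have h1 := (hub S j hjJ).2.2 hj
    have h2 := (hub S' j hjJ).1
    rw [← huu] at h2
    linarith
  have hinj : Function.Injective u := by
    intro S S' huu
    have hb : b S = b S' := le_antisymm (hle S S' huu) (hle S' S huu.symm)
    apply Subtype.ext
    ext j
    constructor
    · intro hj
      have hjJ := hsub S S.2 hj
      refine (hub S' j hjJ).2.1 ?_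
      rw [← huu, ← hb]
      exact (hub S j hjJ).2.2 hj
    · intro hj
      have hjJ := hsub S' S'.2 hj
      refine (hub S j hjJ).2.1 ?_
      rw [huu, hb]
      exact (hub S' j hjJ).2.2 hj
  have key := card_le_Xi_of_tropical (d := d) (k := k) (σ := Γ) J hJ w (fun _ => h) C u hinj
    (fun S _ => b S) (fun S _ j hj => (hub S j hj).1) α ?_ ?_
  · simpa using key
  · intro S i
    rw [hfilter, ← mul_zero (Real.exp (-β S)), ← hcker S i, Finset.mul_sum]
    refine Finset.sum_congr rfl fun j hj => ?_
    rw [hexp S j hj]; ring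
  · intro S hdet
    obtain ⟨v, hv, hMv⟩ := Matrix.exists_mulVec_eq_zero_iff.2 hdet
    apply hv
    -- A vector `v` killed by the Jacobian makes `c j * ⟨v, w j⟩` a kernel vector of `C` on `S`. So
    -- `⟨v, w j⟩` is constant on `S`, which forces `v = 0`.
    obtain ⟨κ, hκ⟩ := hcuniq S (fun j => c S j * ∑ l, v l * (w j l : ℝ)) (by
      intro i
      have h1 := congrFun hMv i
      simp only [Matrix.mulVec, dotProduct, Matrix.of_apply, hfilter, Pi.zero_apply,
        Finset.sum_mul] at h1
      rw [Finset.sum_comm] at h1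
      have h2 : Real.exp (-β S) * ∑ j ∈ (S : Finset ι),
          C i j * (c S j * ∑ l, v l * (w j l : ℝ)) = 0 := by
        rw [← h1, Finset.mul_sum]
        refine Finset.sum_congr rfl fun j hj => ?_
        rw [Finset.mul_sum, Finset.mul_sum, Finset.mul_sum]
        refine Finset.sum_congr rfl fun l _ => ?_
        rw [hexp S j hj]; ring
      exact (mul_eq_zero.1 h2).resolve_left (Real.exp_pos _).ne')
    refine (hint S S.2).eq_zero (hcard S S.2) (b := -κ) fun j hj => ?_
    have h1 := hκ j hj
    rw [mul_comm] at h1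
    have := mul_right_cancel₀ (hcpos S j hj).ne' h1
    linarith

/-! ### The coefficient matrix, dual to a cyclic polytope -/

/-- A kernel vector supported on `S` is a polynomial of degree at most `k` vanishing at the `k`
nodes outside `S`, hence a multiple of their nodal polynomial. Positivity is then a sign condition
on that polynomial. -/
theorem exists_coefficients {ι : Type*} [DecidableEq ι] {d k : ℕ} (J : Finset ι)
    (hJ : J.card = d + k + 1) (τ : ι → ℝ) (hτ : Set.InjOn τ J) :
    ∃ C : Fin d → ι → ℝ, ∀ S ⊆ J, S.card = d + 1 →
      (∃ σ : ℝ, ∀ j ∈ S, 0 < σ * ∏ i ∈ J \ S, (τ j - τ i)) → IsPositivelyDecorated C S := by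
  classical
  let ev : Polynomial.degreeLT ℝ (k + 1) →ₗ[ℝ] (J → ℝ) :=
    (LinearMap.pi fun j : J => Polynomial.leval (τ j)).comp (Submodule.subtype _)
  have hev : ∀ q j, ev q j = (q : Polynomial ℝ).eval (τ j) := fun q j => rfl
  have hinj : Function.Injective ev := by
    rw [injective_iff_map_eq_zero]
    intro q hq
    apply Subtype.ext
    refine Polynomial.eq_zero_of_degree_lt_of_eval_index_eq_zero (s := J) (v := τ) hτ ?_ ?_
    · refine (Polynomial.mem_degreeLT.1 q.2).trans_le ?_
      rw [hJ]
      exact_mod_cast (by omega : k + 1 ≤ d + k + 1)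
    · intro j hj
      exact congrFun hq ⟨j, hj⟩
  have hrank : Module.finrank ℝ (LinearMap.range ev) = k + 1 := by
    rw [LinearMap.finrank_range_of_inj hinj,
      LinearEquiv.finrank_eq (Polynomial.degreeLTEquiv ℝ (k + 1))]
    simp
  have hquot : Module.finrank ℝ ((J → ℝ) ⧸ LinearMap.range ev) = Module.finrank ℝ (Fin d → ℝ) := by
    have := Submodule.finrank_quotient_add_finrank (LinearMap.range ev)
    rw [hrank] at this
    simp [hJ] at this ⊢
    omega
  let Φ := LinearEquiv.ofFinrankEq _ _ hquot
  -- The quotient by the polynomial functions has dimension `d`; the columns of `C` are the images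
  -- of the unit vectors.
  let Θ : (J → ℝ) →ₗ[ℝ] (Fin d → ℝ) := Φ.toLinearMap.comp (LinearMap.range ev).mkQ
  have hΘ : ∀ μ, Θ μ = 0 ↔ ∃ q, ev q = μ := by
    intro μ
    simp only [Θ, LinearMap.comp_apply, LinearEquiv.coe_coe, LinearEquiv.map_eq_zero_iff,
      Submodule.mkQ_apply, Submodule.Quotient.mk_eq_zero, LinearMap.mem_range]
  let C : Fin d → ι → ℝ := fun i j => if hj : j ∈ J then Θ (Pi.single ⟨j, hj⟩ 1) i else 0
  have hC : ∀ (μ : ι → ℝ), ∀ S ⊆ J, ∀ i,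
      ∑ j ∈ S, C i j * μ j = Θ (fun j => if (j : ι) ∈ S then μ j else 0) i := by
    intro μ S hS i
    have h1 : (fun j : J => if (j : ι) ∈ S then μ j else 0) =
        ∑ j : J, (if (j : ι) ∈ S then μ j else 0) • Pi.single j (1 : ℝ) := by
      exact pi_eq_sum_univ' _
    rw [h1, map_sum, Finset.sum_apply]
    simp only [map_smul, Pi.smul_apply, smul_eq_mul]
    have h2 : ∀ j : J, (if (j : ι) ∈ S then μ j else 0) * Θ (Pi.single j 1) i =
        (fun j : ι => if j ∈ S then C i j * μ j else 0) j := by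
      intro j
      by_cases hj : (j : ι) ∈ S
      · simp only [hj, if_true, C, j.2, dif_pos]
        ring
      · simp [hj]
    rw [Finset.sum_congr rfl fun j _ => h2 j, Finset.sum_coe_sort J (fun j : ι =>
      if j ∈ S then C i j * μ j else 0), ← Finset.sum_filter, Finset.filter_mem_eq_inter,
      Finset.inter_eq_right.2 hS]
  refine ⟨C, fun S hS hcard hσ => ?_⟩
  obtain ⟨σ, hσ⟩ := hσ
  have hcard' : (J \ S).card = k := by
    rw [Finset.card_sdiff_of_subset hS]; omega
  let Q : Polynomial ℝ := Lagrange.nodal (J \ S) τ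
  have hQdeg : Q.degree = k := by rw [Lagrange.degree_nodal, hcard']
  have hQev : ∀ x, Q.eval x = ∏ i ∈ J \ S, (x - τ i) := fun x => Lagrange.eval_nodal
  have hQmonic : Q.Monic := Lagrange.nodal_monic
  obtain ⟨j₀, hj₀⟩ : S.Nonempty := Finset.card_pos.1 (by omega)
  have hσ0 : σ ≠ 0 := by
    rintro rfl
    simpa using hσ j₀ hj₀
  refine ⟨fun j => σ * Q.eval (τ j), fun j hj => by simpa only [hQev] using hσ j hj, fun i => ?_,
    fun μ hμ => ?_⟩
  · rw [hC _ S hS]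
    refine congrFun ((hΘ _).2 ⟨⟨Polynomial.C σ * Q, ?_⟩, funext fun j => ?_⟩) i
    · rw [Polynomial.mem_degreeLT]
      rw [Polynomial.degree_C_mul hσ0, hQdeg]
      exact_mod_cast Nat.lt_succ_self k
    · rw [hev]
      by_cases hj : (j : ι) ∈ S
      · simp [hj]
      · simp only [hj, if_false, Polynomial.eval_mul, Polynomial.eval_C, hQev]
        rw [Finset.prod_eq_zero (Finset.mem_sdiff.2 ⟨j.2, hj⟩) (sub_self _), mul_zero]
  · obtain ⟨q, hq⟩ := (hΘ (fun j => if (j : ι) ∈ S then μ j else 0)).1 (by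
      funext i
      rw [← hC μ S hS, hμ i]; rfl)
    have hqS : ∀ j ∈ S, (q : Polynomial ℝ).eval (τ j) = μ j := by
      intro j hj
      have := congrFun hq ⟨j, hS hj⟩
      rw [hev] at this
      simpa [hj] using this
    have hqJ : ∀ j ∈ J \ S, (q : Polynomial ℝ).eval (τ j) = 0 := by
      intro j hj
      rw [Finset.mem_sdiff] at hj
      have := congrFun hq ⟨j, hj.1⟩
      rw [hev] at this
      simpa [hj.2] using this
    -- Removing the leading term with the monic `Q` leaves degree below `k` and `k` roots.
    obtain ⟨a, ha⟩ : ∃ a : ℝ, (q : Polynomial ℝ) = Polynomial.C a * Q := by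
      refine ⟨(q : Polynomial ℝ).coeff k, ?_⟩
      rw [← sub_eq_zero]
      refine Polynomial.eq_zero_of_degree_lt_of_eval_index_eq_zero (s := J \ S) (v := τ)
        (hτ.mono (Finset.coe_subset.2 Finset.sdiff_subset)) ?_ ?_
      · rw [hcard', Polynomial.degree_lt_iff_coeff_zero]
        intro m hm
        have hQc : Q.coeff k = 1 := by
          have := hQmonic.coeff_natDegree
          rwa [Polynomial.natDegree_eq_of_degree_eq_some hQdeg] at this
        rw [Polynomial.coeff_sub, Polynomial.coeff_C_mul]
        rcases hm.eq_or_lt with rfl | hm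
        · rw [hQc]; ring
        · rw [Polynomial.coeff_eq_zero_of_degree_lt (p := Q)
            (by rw [hQdeg]; exact_mod_cast hm),
            Polynomial.coeff_eq_zero_of_degree_lt (p := (q : Polynomial ℝ))
            ((Polynomial.mem_degreeLT.1 q.2).trans_le (by exact_mod_cast hm))]
          ring
      · intro j hj
        rw [Polynomial.eval_sub, hqJ j hj, Polynomial.eval_mul, hQev,
          Finset.prod_eq_zero hj (sub_self _)]
        ring
    refine ⟨a / σ, fun j hj => ?_⟩
    rw [← hqS j hj, ha, Polynomial.eval_mul, Polynomial.eval_C]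
    field_simp

/-! ### Lower faces by projecting a cyclic polytope -/

/-- `S` is (the vertex set of) a facet of the cyclic polytope with nodes `s j`, `j ∈ J`, of
dimension the cardinality of `S`. -/
def IsCyclicFacet {ι : Type*} [DecidableEq ι] (s : ι → ℝ) (J S : Finset ι) : Prop :=
  ∃ σ : ℝ, ∀ j ∈ J \ S, 0 < σ * ∏ i ∈ S, (s j - s i)

/-- Only the sign of the scalar matters; the values `±1` keep the later construction rational. -/
theorem IsCyclicFacet.exists_sign {ι : Type*} [DecidableEq ι] {s : ι → ℝ} {J S : Finset ι}
    (h : IsCyclicFacet s J S) :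
    ∃ σ : ℝ, (σ = 1 ∨ σ = -1) ∧ ∀ j ∈ J \ S, 0 < σ * ∏ i ∈ S, (s j - s i) := by
  obtain ⟨σ, hσ⟩ := h
  rcases lt_trichotomy σ 0 with h | h | h
  · refine ⟨-1, Or.inr rfl, fun j hj => ?_⟩
    have := neg_of_mul_pos_right (hσ j hj) h.le
    linarith
  · refine ⟨1, Or.inl rfl, fun j hj => ?_⟩
    have := hσ j hj
    rw [h, zero_mul] at this
    exact absurd this (lt_irrefl 0)
  · refine ⟨1, Or.inl rfl, fun j hj => ?_⟩
    have := pos_of_mul_pos_right (hσ j hj) h.le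
    linarith

/-- The functional `p ↦ ∑ j ∈ A, p (s j) - δ * ∑ j ∈ B, p (s j)` on polynomials. -/
noncomputable def weightedEval {ι : Type*} (s : ι → ℝ) (A B : Finset ι) (δ : ℝ) :
    Polynomial ℝ →ₗ[ℝ] ℝ :=
  ∑ j ∈ A, Polynomial.leval (s j) - δ • ∑ j ∈ B, Polynomial.leval (s j)

theorem weightedEval_apply {ι : Type*} (s : ι → ℝ) (A B : Finset ι) (δ : ℝ) (p : Polynomial ℝ) :
    weightedEval s A B δ p = ∑ j ∈ A, p.eval (s j) - δ * ∑ j ∈ B, p.eval (s j) := by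
  simp [weightedEval, LinearMap.sum_apply]

/-- Projection of the moment curve along a direction `e`, followed by a projective transformation
with denominator `q`, expressed in coordinates. -/
theorem exists_affine_of_polynomial {d : ℕ} (e : Polynomial ℝ →ₗ[ℝ] ℝ) (he : e 1 ≠ 0)
    (q : Polynomial ℝ) (hq : e q = 0) (hqdeg : q.natDegree ≤ d + 1) (hqc : q.coeff (d + 1) ≠ 0)
    (p : Polynomial ℝ) (hp : p.natDegree ≤ d + 1) :
    ∃ (y : Fin d → ℝ) (b : ℝ), ∀ x : ℝ, q.eval x ≠ 0 → p.eval x / q.eval x =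
      e p / e 1 * (1 / q.eval x) +
        ∑ l, y l * ((x ^ (l.1 + 1) - e (Polynomial.X ^ (l.1 + 1)) / e 1) / q.eval x) + b := by
  -- Subtracting `γ * q` removes the top coefficient without changing the value of `e`, so the
  -- remainder is a combination of `1, x, …, x ^ d`.
  let γ := p.coeff (d + 1) / q.coeff (d + 1)
  let r := p - Polynomial.C γ * q
  have hr : r.natDegree < d + 1 := by
    have h1 : r.natDegree ≤ d + 1 := by
      refine (Polynomial.natDegree_sub_le _ _).trans (max_le hp ?_)
      exact (Polynomial.natDegree_C_mul_le _ _).trans hqdeg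
    have h2 : r.coeff (d + 1) = 0 := by
      simp only [r, Polynomial.coeff_sub, Polynomial.coeff_C_mul, γ]
      field_simp
      ring
    refine lt_of_le_of_ne h1 fun h => ?_
    rw [← h, Polynomial.coeff_natDegree, Polynomial.leadingCoeff_eq_zero] at h2
    rw [h2] at h
    simp at h
  have hsum : r = Polynomial.C (r.coeff 0) * 1 +
      ∑ l : Fin d, Polynomial.C (r.coeff (l.1 + 1)) * Polynomial.X ^ (l.1 + 1) := by
    conv_lhs => rw [r.as_sum_range' (d + 1) hr]
    rw [Finset.sum_range_succ', add_comm, Finset.sum_range]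
    simp [Polynomial.C_mul_X_pow_eq_monomial]
  have her : e r = r.coeff 0 * e 1 +
      ∑ l : Fin d, r.coeff (l.1 + 1) * e (Polynomial.X ^ (l.1 + 1)) := by
    conv_lhs => rw [hsum]
    simp only [map_add, map_sum, ← Polynomial.smul_eq_C_mul, map_smul, smul_eq_mul]
  have hep : e p = e r := by
    simp only [r, map_sub, ← Polynomial.smul_eq_C_mul, map_smul, hq, smul_zero, sub_zero]
  refine ⟨fun l => r.coeff (l.1 + 1), γ, fun x hx => ?_⟩
  have hrx : r.eval x = r.coeff 0 + ∑ l : Fin d, r.coeff (l.1 + 1) * x ^ (l.1 + 1) := by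
    conv_lhs => rw [hsum]
    simp [Polynomial.eval_finsetSum]
  have hpx : p.eval x = r.eval x + γ * q.eval x := by
    simp [r]
  rw [hep, her, hpx, hrx]
  simp only [mul_div_assoc', ← Finset.sum_div, mul_sub, Finset.sum_sub_distrib]
  field_simp
  ring

/-- A point just outside the polytope beyond `G` sees no facet in `Γ`. A projective map sending a
hyperplane through that point to infinity turns projection from it into vertical projection, with
height `1 / q`, and the facets in `Γ` become lower faces. -/
theorem exists_isLowerFace {ι : Type*} [DecidableEq ι] {d : ℕ} (J : Finset ι) (s : ι → ℝ)
    (hs : Set.InjOn s J) (hrat : ∀ j ∈ J, s j ∈ (algebraMap ℚ ℝ).fieldRange)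
    (hJ : d + 1 < J.card) (G : Finset ι) (hGJ : G ⊆ J) (hGcard : G.card = d + 1)
    (hG : IsCyclicFacet s J G) (Γ : Finset (Finset ι)) (hGΓ : G ∉ Γ)
    (hsub : ∀ S ∈ Γ, S ⊆ J) (hcard : ∀ S ∈ Γ, S.card = d + 1)
    (hΓ : ∀ S ∈ Γ, IsCyclicFacet s J S) :
    ∃ (w : ι → Fin d → ℝ) (h : ι → ℝ), (∀ j ∈ J, ∀ l, w j l ∈ (algebraMap ℚ ℝ).fieldRange) ∧
      ∀ S ∈ Γ, IsLowerFace w h J S ∧ AffinelyInterpolates w S := by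
  classical
  have hsign : ∀ S ∈ insert G Γ, ∃ σ : ℝ, (σ = 1 ∨ σ = -1) ∧
      ∀ j ∈ J \ S, 0 < σ * ∏ i ∈ S, (s j - s i) := by
    intro S hS
    rcases Finset.mem_insert.1 hS with rfl | hS
    · exact hG.exists_sign
    · exact (hΓ S hS).exists_sign
  choose! σ hσ1 hσ using hsign
  have hcard' : ∀ S ∈ insert G Γ, S.card = d + 1 := by
    intro S hS
    rcases Finset.mem_insert.1 hS with rfl | hS
    · exact hGcard
    · exact hcard S hS
  let P : Finset ι → Polynomial ℝ := fun S => Polynomial.C (σ S) * Lagrange.nodal S s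
  have hPev : ∀ S x, (P S).eval x = σ S * ∏ i ∈ S, (x - s i) := fun S x => by
    simp [P, Lagrange.eval_nodal]
  have hPzero : ∀ S, ∀ j ∈ S, (P S).eval (s j) = 0 := fun S j hj => by
    rw [hPev, Finset.prod_eq_zero hj (sub_self _), mul_zero]
  have hPpos : ∀ S ∈ insert G Γ, ∀ j ∈ J, j ∉ S → 0 < (P S).eval (s j) := fun S hS j hj hjS => by
    rw [hPev]; exact hσ S hS j (Finset.mem_sdiff.2 ⟨hj, hjS⟩)
  have hPnonneg : ∀ S ∈ insert G Γ, ∀ j ∈ J, 0 ≤ (P S).eval (s j) := fun S hS j hj => by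
    by_cases hjS : j ∈ S
    · exact (hPzero S j hjS).ge
    · exact (hPpos S hS j hj hjS).le
  have hPdeg : ∀ S ∈ insert G Γ, (P S).natDegree ≤ d + 1 := fun S hS => by
    refine (Polynomial.natDegree_C_mul_le _ _).trans ?_
    rw [Lagrange.natDegree_nodal, hcard' S hS]
  have hevδ : ∀ p : Polynomial ℝ, 0 < ∑ j ∈ G, p.eval (s j) →
      ∀ᶠ n : ℕ in atTop, 0 < weightedEval s G (J \ G) (1 / ((n : ℝ) + 1)) p := by
    intro p hp
    have h1 : Tendsto (fun n : ℕ => weightedEval s G (J \ G) (1 / ((n : ℝ) + 1)) p) atTop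
        (𝓝 (∑ j ∈ G, p.eval (s j) - 0 * ∑ j ∈ J \ G, p.eval (s j))) := by
      simp only [weightedEval_apply]
      exact tendsto_const_nhds.sub (tendsto_one_div_add_atTop_nhds_zero_nat.mul_const _)
    rw [zero_mul, sub_zero] at h1
    exact h1.eventually_const_lt hp
  have hGne : G.Nonempty := Finset.card_pos.1 (by omega)
  have hev1 := hevδ 1 (by simp [hGcard]; positivity)
  have hevΓ : ∀ᶠ n : ℕ in atTop, ∀ S ∈ Γ,
      0 < weightedEval s G (J \ G) (1 / ((n : ℝ) + 1)) (P S) := by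
    rw [Finset.eventually_all]
    intro S hS
    refine hevδ _ ?_
    have hGS : ¬ G ⊆ S := by
      intro hGS
      have := Finset.eq_of_subset_of_card_le hGS (by rw [hGcard, hcard S hS])
      exact hGΓ (this ▸ hS)
    obtain ⟨j, hjG, hjS⟩ := Finset.not_subset.1 hGS
    refine Finset.sum_pos' (fun j hj => hPnonneg S (Finset.mem_insert_of_mem hS) j (hGJ hj))
      ⟨j, hjG, hPpos S (Finset.mem_insert_of_mem hS) j (hGJ hjG) hjS⟩
  obtain ⟨n, hn1, hnΓ⟩ := (hev1.and hevΓ).exists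
  set δ : ℝ := 1 / ((n : ℝ) + 1) with hδ
  have hδ0 : 0 < δ := by positivity
  -- Up to normalisation `e` is that point: the centroid of `G` pushed slightly away from the other
  -- vertices. It is negative on `P G` and positive on `P S` for `S ∈ Γ`; the form of `δ` makes it
  -- rational.
  set e := weightedEval s G (J \ G) δ with he
  have hGG : G ∈ insert G Γ := Finset.mem_insert_self _ _
  have hcompl : (J \ G).Nonempty := by
    rw [← Finset.card_pos, Finset.card_sdiff_of_subset hGJ]; omega
  have heG : e (P G) < 0 := by
    rw [he, weightedEval_apply, Finset.sum_eq_zero (hPzero G), zero_sub, neg_lt_zero]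
    refine mul_pos hδ0 (Finset.sum_pos (fun j hj => ?_) hcompl)
    rw [Finset.mem_sdiff] at hj
    exact hPpos G hGG j hj.1 hj.2
  -- Chosen so that `e q = 0`. It is positive because `e (P G) < 0`, hence `q` is positive at all
  -- nodes.
  let c : ℝ := -(e 1 / e (P G))
  have hc : 0 < c := neg_pos.2 (div_neg_of_pos_of_neg hn1 heG)
  let q : Polynomial ℝ := 1 + Polynomial.C c * P G
  have heq : e q = 0 := by
    simp only [q, map_add, ← Polynomial.smul_eq_C_mul, map_smul, smul_eq_mul, c]
    field_simp [heG.ne]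
    ring
  have hqpos : ∀ j ∈ J, 0 < q.eval (s j) := fun j hj => by
    have := mul_nonneg hc.le (hPnonneg G hGG j hj)
    simp only [q, Polynomial.eval_add, Polynomial.eval_one, Polynomial.eval_mul,
      Polynomial.eval_C]
    linarith
  have hqdeg : q.natDegree ≤ d + 1 := by
    refine (Polynomial.natDegree_add_le _ _).trans (max_le (by simp) ?_)
    exact (Polynomial.natDegree_C_mul_le _ _).trans (hPdeg G hGG)
  have hσne : ∀ S ∈ insert G Γ, σ S ≠ 0 := fun S hS => by
    rcases hσ1 S hS with h | h <;> rw [h] <;> norm_num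
  have hqc : q.coeff (d + 1) ≠ 0 := by
    have h1 : (Lagrange.nodal G s).coeff (d + 1) = 1 := by
      have := (Lagrange.nodal_monic (s := G) (v := s)).coeff_natDegree
      rwa [Lagrange.natDegree_nodal, hGcard] at this
    simp only [q, P, Polynomial.coeff_add, Polynomial.coeff_C_mul, h1, mul_one,
      Polynomial.coeff_one, Nat.succ_ne_zero, if_false, zero_add]
    exact mul_ne_zero hc.ne' (hσne G hGG)
  let w : ι → Fin d → ℝ := fun j l =>
    ((s j) ^ (l.1 + 1) - e (Polynomial.X ^ (l.1 + 1)) / e 1) / q.eval (s j)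
  have haff := exists_affine_of_polynomial e hn1.ne' q heq hqdeg hqc
  refine ⟨w, fun j => 1 / q.eval (s j), fun j hj l => ?_, fun S hS => ⟨?_, ?_⟩⟩
  · set K := (algebraMap ℚ ℝ).fieldRange with hK
    have hδK : δ ∈ K := K.div_mem K.one_mem (K.add_mem (natCast_mem K n) K.one_mem)
    have heK : ∀ p : Polynomial ℝ, (∀ j ∈ J, p.eval (s j) ∈ K) → e p ∈ K := by
      intro p hp
      rw [he, weightedEval_apply]
      exact K.sub_mem (K.sum_mem fun j hj => hp j (hGJ hj))
        (K.mul_mem hδK (K.sum_mem fun j hj => hp j (Finset.sdiff_subset hj)))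
    have hPK : ∀ j ∈ J, (P G).eval (s j) ∈ K := by
      intro j hj
      rw [hPev]
      refine K.mul_mem ?_ (K.prod_mem fun i hi => K.sub_mem (hrat j hj) (hrat i (hGJ hi)))
      rcases hσ1 G hGG with h | h <;> rw [h]
      · exact K.one_mem
      · exact K.neg_mem K.one_mem
    have he1K : e 1 ∈ K := heK 1 fun j _ => by rw [Polynomial.eval_one]; exact K.one_mem
    refine K.div_mem (K.sub_mem (K.pow_mem (hrat j hj) _) (K.div_mem (heK _ fun i hi => ?_) he1K)) ?_
    · rw [Polynomial.eval_pow, Polynomial.eval_X]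
      exact K.pow_mem (hrat i hi) _
    · simp only [q, Polynomial.eval_add, Polynomial.eval_one, Polynomial.eval_mul,
        Polynomial.eval_C]
      exact K.add_mem K.one_mem (K.mul_mem (K.neg_mem (K.div_mem he1K (heK _ hPK))) (hPK j hj))
  · have hSS : S ∈ insert G Γ := Finset.mem_insert_of_mem hS
    -- The factor normalises the coefficient of the height to `1`.
    obtain ⟨y, b, hyb⟩ := haff (Polynomial.C (e 1 / e (P S)) * P S)
      ((Polynomial.natDegree_C_mul_le _ _).trans (hPdeg S hSS))
    refine ⟨y, b, fun j hj => ?_⟩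
    have h1 := hyb (s j) (hqpos j hj).ne'
    have h2 : e (Polynomial.C (e 1 / e (P S)) * P S) / e 1 = 1 := by
      rw [← Polynomial.smul_eq_C_mul, map_smul, smul_eq_mul]
      have := (hnΓ S hS).ne'
      have := hn1.ne'
      field_simp
    rw [h2, one_mul] at h1
    simp only [w]
    rw [← h1, Polynomial.eval_mul, Polynomial.eval_C]
    have hr : 0 < e 1 / e (P S) := div_pos hn1 (hnΓ S hS)
    refine ⟨div_nonneg (mul_nonneg hr.le (hPnonneg S hSS j hj)) (hqpos j hj).le, ?_, ?_⟩
    · intro h0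
      by_contra hjS
      exact (div_pos (mul_pos hr (hPpos S hSS j hj hjS)) (hqpos j hj)).ne' h0
    · intro hjS
      rw [hPzero S j hjS, mul_zero, zero_div]
  · intro g
    have hSS : S ∈ insert G Γ := Finset.mem_insert_of_mem hS
    have hsS : Set.InjOn s S := hs.mono (Finset.coe_subset.2 (hsub S hS))
    let p₀ := Lagrange.interpolate S s fun j => g j * q.eval (s j)
    -- `P S` vanishes on `S`, so this correction keeps the interpolated values while removing the
    -- height term.
    let p := p₀ - Polynomial.C (e p₀ / e (P S)) * P S
    have hp₀ : p₀.natDegree ≤ d + 1 := by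
      have := (Lagrange.degree_interpolate_lt (fun j => g j * q.eval (s j)) hsS).le
      rw [hcard S hS] at this
      exact Polynomial.natDegree_le_of_degree_le this
    have hp : p.natDegree ≤ d + 1 := by
      refine (Polynomial.natDegree_sub_le _ _).trans (max_le hp₀ ?_)
      exact (Polynomial.natDegree_C_mul_le _ _).trans (hPdeg S hSS)
    have hep : e p = 0 := by
      simp only [p, map_sub, ← Polynomial.smul_eq_C_mul, map_smul, smul_eq_mul]
      have := (hnΓ S hS).ne'
      field_simp
      ring
    obtain ⟨y, b, hyb⟩ := haff p hp
    refine ⟨y, b, fun j hj => ?_⟩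
    have hq := (hqpos j (hsub S hS hj)).ne'
    have h1 := hyb (s j) hq
    rw [hep, zero_div, zero_mul, zero_add] at h1
    simp only [w]
    rw [← h1]
    simp only [p, Polynomial.eval_sub, Polynomial.eval_mul, hPzero S j hj, mul_zero, sub_zero]
    simp only [p₀]
    rw [Lagrange.eval_interpolate_at_node _ hsS hj]
    field_simp

/-- Clear denominators, then translate to reach nonnegative exponents; such a map preserves faces
and affine interpolation. -/
theorem exists_natCast_eq_mul_add {ι : Type*} [DecidableEq ι] {d : ℕ} (J : Finset ι)
    (w : ι → Fin d → ℝ) (hw : ∀ j ∈ J, ∀ l, w j l ∈ (algebraMap ℚ ℝ).fieldRange) :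
    ∃ (N : ℕ) (M : ℝ) (w' : ι → Fin d → ℕ), 0 < N ∧
      ∀ j ∈ J, ∀ l, (w' j l : ℝ) = N * w j l + M := by
  classical
  have hr : ∀ j l, ∃ r : ℚ, j ∈ J → (r : ℝ) = w j l := by
    intro j l
    by_cases hj : j ∈ J
    · obtain ⟨r, hr⟩ := hw j hj l
      exact ⟨r, fun _ => by rw [← hr]; simp⟩
    · exact ⟨0, fun h => absurd h hj⟩
  choose r hr using hr
  let N : ℕ := ∏ p ∈ J ×ˢ (Finset.univ : Finset (Fin d)), (r p.1 p.2).den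
  have hN : 0 < N := Finset.prod_pos fun p _ => (r p.1 p.2).den_pos
  have hz : ∀ j l, ∃ z : ℤ, j ∈ J → (z : ℝ) = N * w j l := by
    intro j l
    by_cases hj : j ∈ J
    · have hdvd : (r j l).den ∣ N :=
        Finset.dvd_prod_of_mem (fun p : ι × Fin d => (r p.1 p.2).den)
          (a := (j, l))
          (Finset.mem_product.2 ⟨hj, Finset.mem_univ l⟩)
      obtain ⟨a, ha⟩ := hdvd
      refine ⟨a * (r j l).num, fun _ => ?_⟩
      rw [← hr j l hj, ha]
      have h1 : ((r j l).den : ℝ) * ((r j l : ℚ) : ℝ) = (r j l).num := by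
        exact_mod_cast Rat.den_mul_eq_num (r j l)
      push_cast
      rw [← h1]; ring
    · exact ⟨0, fun h => absurd h hj⟩
  choose z hz using hz
  let M : ℤ := ∑ p ∈ J ×ˢ (Finset.univ : Finset (Fin d)), |z p.1 p.2|
  refine ⟨N, M, fun j l => (z j l + M).toNat, hN, fun j hj l => ?_⟩
  have h1 : |z j l| ≤ M := Finset.single_le_sum (f := fun p : ι × Fin d => |z p.1 p.2|)
    (a := (j, l)) (fun p _ => abs_nonneg _) (Finset.mem_product.2 ⟨hj, Finset.mem_univ l⟩)
  have h2 : 0 ≤ z j l + M := by linarith [neg_abs_le (z j l)]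
  have h3 : (((z j l + M).toNat : ℤ) : ℝ) = ((z j l + M : ℤ) : ℝ) := by rw [Int.toNat_of_nonneg h2]
  rw [← hz j l hj]
  rw [Int.cast_natCast] at h3
  rw [h3]; push_cast; ring

theorem exists_affine_eq_of_eq_mul_add {ι : Type*} {d : ℕ} {J : Finset ι}
    {w w' : ι → Fin d → ℝ} {N M : ℝ} (hN : N ≠ 0) (h : ∀ j ∈ J, ∀ l, w' j l = N * w j l + M)
    (y : Fin d → ℝ) (b : ℝ) :
    ∃ (y' : Fin d → ℝ) (b' : ℝ), ∀ j ∈ J, ∑ l, y' l * w' j l + b' = ∑ l, y l * w j l + b := by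
  refine ⟨fun l => y l / N, b - ∑ l, y l / N * M, fun j hj => ?_⟩
  have : ∀ l, y l / N * w' j l = y l * w j l + y l / N * M := by
    intro l
    rw [h j hj l]
    field_simp
  simp only [this, Finset.sum_add_distrib]
  ring

theorem card_le_Xi_of_isCyclicFacet {ι : Type*} [DecidableEq ι] {d k : ℕ} (J J' : Finset ι)
    (hJJ : J' ⊆ J) (hJ' : J'.card ≤ d + k + 1) (s : ι → ℝ) (hs : Set.InjOn s J)
    (hrat : ∀ j ∈ J, s j ∈ (algebraMap ℚ ℝ).fieldRange) (hJ : d + 1 < J.card)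
    (G : Finset ι) (hGJ : G ⊆ J) (hGcard : G.card = d + 1) (hG : IsCyclicFacet s J G)
    (C : Fin d → ι → ℝ) (Γ : Finset (Finset ι)) (hGΓ : G ∉ Γ) (hsub : ∀ S ∈ Γ, S ⊆ J')
    (hcard : ∀ S ∈ Γ, S.card = d + 1) (hΓ : ∀ S ∈ Γ, IsCyclicFacet s J S)
    (hdec : ∀ S ∈ Γ, IsPositivelyDecorated C S) :
    (Γ.card : ℕ∞) ≤ Xi d k := by
  obtain ⟨w, h, hw, hface⟩ := exists_isLowerFace J s hs hrat hJ G hGJ hGcard hG Γ hGΓ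
    (fun S hS => (hsub S hS).trans hJJ) hcard hΓ
  obtain ⟨N, M, w', hN, hw'⟩ := exists_natCast_eq_mul_add J w hw
  have hN' : (N : ℝ) ≠ 0 := by exact_mod_cast hN.ne'
  have haff := exists_affine_eq_of_eq_mul_add (w' := fun j l => (w' j l : ℝ)) hN' hw'
  refine card_le_Xi_of_decorated J' hJ' w' h C Γ hsub hcard (fun S hS => ?_) (fun S hS g => ?_)
    hdec
  · obtain ⟨y, b, hyb⟩ := (hface S hS).1
    obtain ⟨y', b', hyb'⟩ := haff y b
    refine ⟨y', b', fun j hj => ?_⟩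
    have h1 := hyb j (hJJ hj)
    rwa [add_assoc, ← hyb' j (hJJ hj), ← add_assoc] at h1
  · obtain ⟨y, b, hyb⟩ := (hface S hS).2 g
    obtain ⟨y', b', hyb'⟩ := haff y b
    refine ⟨y', b', fun j hj => ?_⟩
    rw [hyb' j (hJJ (hsub S hS hj)), hyb j hj]

/-! ### The Delannoy recursion -/

theorem delannoy_zero_right (h : ℕ) : delannoy h 0 = 1 := by simp [delannoy]

theorem delannoy_zero_left (k : ℕ) : delannoy 0 k = 1 := by simp [delannoy]

theorem delannoy_eq_sum_range {i j n : ℕ} (h : min i j ≤ n) :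
    delannoy i j = ∑ l ∈ Finset.range (n + 1), 2 ^ l * i.choose l * j.choose l := by
  rw [delannoy]
  refine Finset.sum_subset (Finset.range_subset_range.2 (by omega)) fun l _ hl => ?_
  rw [Finset.mem_range, not_lt] at hl
  rcases le_total i j with hij | hij
  · rw [min_eq_left hij] at hl
    rw [Nat.choose_eq_zero_of_lt (show i < l by omega)]; simp
  · rw [min_eq_right hij] at hl
    rw [Nat.choose_eq_zero_of_lt (show j < l by omega)]; simp

/-- Pascal's rule in both binomials, term by term; `delannoy i j` is added to both sides to avoid
subtraction. -/
theorem delannoy_succ_succ (i j : ℕ) :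
    delannoy (i + 1) (j + 1) = delannoy i (j + 1) + delannoy (i + 1) j + delannoy i j := by
  have h1 := delannoy_eq_sum_range (i := i + 1) (j := j + 1) (n := i + 1) (by omega)
  have h2 := delannoy_eq_sum_range (i := i) (j := j + 1) (n := i + 1) (by omega)
  have h3 := delannoy_eq_sum_range (i := i + 1) (j := j) (n := i + 1) (by omega)
  have h4 := delannoy_eq_sum_range (i := i) (j := j) (n := i + 1) (by omega)
  have h5 := delannoy_eq_sum_range (i := i) (j := j) (n := i) (by omega)
  rw [Finset.sum_range_succ'] at h1 h2 h3 h4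
  have key : ∀ l, 2 ^ (l + 1) * (i + 1).choose (l + 1) * (j + 1).choose (l + 1) +
      2 ^ (l + 1) * i.choose (l + 1) * j.choose (l + 1) =
      2 ^ (l + 1) * i.choose (l + 1) * (j + 1).choose (l + 1) +
      2 ^ (l + 1) * (i + 1).choose (l + 1) * j.choose (l + 1) +
      2 * (2 ^ l * i.choose l * j.choose l) := by
    intro l
    rw [Nat.choose_succ_succ i l, Nat.choose_succ_succ j l]
    ring
  have hsum := Finset.sum_congr (rfl : Finset.range (i + 1) = _) fun l _ => key l
  simp only [Finset.sum_add_distrib, ← Finset.mul_sum] at hsum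
  rw [← h5] at hsum
  simp only [pow_zero, Nat.choose_zero_right, mul_one] at h1 h2 h3 h4
  omega

/-! ### Facets from lattice paths -/

/-- The involution of `ℕ` exchanging `2 * c` and `2 * c + 1`. -/
def pairSwap (x : ℕ) : ℕ := if x % 2 = 0 then x + 1 else x - 1

theorem pairSwap_two_mul (c : ℕ) : pairSwap (2 * c) = 2 * c + 1 := by
  rw [pairSwap, if_pos (by omega)]

theorem pairSwap_two_mul_add_one (c : ℕ) : pairSwap (2 * c + 1) = 2 * c := by
  rw [pairSwap, if_neg (by omega)]; omega

theorem pairSwap_pairSwap (x : ℕ) : pairSwap (pairSwap x) = x := by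
  unfold pairSwap; split_ifs <;> omega

theorem pairSwap_injective : Function.Injective pairSwap :=
  Function.LeftInverse.injective pairSwap_pairSwap

theorem sub_mul_sub_add_one_pos {x a : ℕ} (h : x ≠ a) (h' : x ≠ a + 1) :
    0 < ((x : ℝ) - a) * ((x : ℝ) - (a + 1 : ℕ)) := by
  push_cast
  rcases lt_or_gt_of_ne h with h1 | h1
  · have : (x : ℝ) + 1 ≤ a := by exact_mod_cast h1
    nlinarith
  · have : (a : ℝ) + 2 ≤ x := by exact_mod_cast (by omega : a + 2 ≤ x)
    nlinarith

/-- The faces encoded by lattice paths with `h` horizontal, `k` vertical steps (where a diagonal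
step counts as both), drawn on the columns `{2 * i, 2 * i + 1}` for `c ≤ i < c + h + k`; `R` is the
complement of `S`. Both `S` and the image of `R` under `pairSwap` are disjoint unions of pairs of
consecutive integers. -/
structure IsPathFacet (c h k : ℕ) (S R : Finset ℕ) : Prop where
  mem_or_mem : ∀ x, x ∈ S ∨ x ∈ R ↔ 2 * c ≤ x ∧ x < 2 * (c + h + k)
  disjoint : ∀ x ∈ S, x ∉ R
  card : S.card = 2 * k
  start : 2 * c ∈ S → 2 * c + 1 ∈ S
  pos : ∀ x : ℕ, x ∉ S → 0 < ∏ i ∈ S, ((x : ℝ) - i)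
  dual_pos : ∀ y : ℕ, (∀ i ∈ R, y ≠ pairSwap i) → 0 < ∏ i ∈ R, ((y : ℝ) - pairSwap i)

/-- Gale's evenness: a pair of consecutive nodes contributes a positive factor at every other
integer. -/
theorem prod_insert_insert_pos {S : Finset ℕ} {f : ℕ → ℕ} {a b t x : ℕ} (ha : a ∉ insert b S)
    (hb : b ∉ S) (hab : (f a = t ∧ f b = t + 1) ∨ (f a = t + 1 ∧ f b = t)) (h1 : x ≠ t)
    (h2 : x ≠ t + 1) (hS : 0 < ∏ i ∈ S, ((x : ℝ) - f i)) :
    0 < ∏ i ∈ insert a (insert b S), ((x : ℝ) - f i) := by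
  rw [Finset.prod_insert ha, Finset.prod_insert hb, ← mul_assoc]
  refine mul_pos ?_ hS
  have := sub_mul_sub_add_one_pos h1 h2
  rcases hab with ⟨h3, h4⟩ | ⟨h3, h4⟩ <;> rw [h3, h4]
  · exact this
  · rwa [mul_comm]

namespace IsPathFacet

variable {c h k : ℕ} {S R : Finset ℕ}

theorem notMem_of_le (H : IsPathFacet c h k S R) {x : ℕ} (hx : 2 * (c + h + k) ≤ x) :
    x ∉ S ∧ x ∉ R := by
  have := H.mem_or_mem x
  constructor <;> intro hx' <;> simp only [hx', true_or, or_true, true_iff] at this <;> omega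

theorem notMem_of_lt (H : IsPathFacet c h k S R) {x : ℕ} (hx : x < 2 * c) :
    x ∉ S ∧ x ∉ R := by
  have := H.mem_or_mem x
  constructor <;> intro hx' <;> simp only [hx', true_or, or_true, true_iff] at this <;> omega

theorem nil (c : ℕ) : IsPathFacet c 0 0 ∅ ∅ where
  mem_or_mem x := by simp
  disjoint x hx := by simp at hx
  card := rfl
  start h := by simp at h
  pos x _ := by simp
  dual_pos y _ := by simp

theorem horizontal (H : IsPathFacet c h k S R) :
    IsPathFacet c (h + 1) k S
      (insert (2 * (c + h + k)) (insert (2 * (c + h + k) + 1) R)) := by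
  have n1 := H.notMem_of_le (x := 2 * (c + h + k)) le_rfl
  have n2 := H.notMem_of_le (x := 2 * (c + h + k) + 1) (by omega)
  refine ⟨fun x => ?_, fun x hx => ?_, H.card, H.start, H.pos, fun y hy => ?_⟩
  · have := H.mem_or_mem x
    simp only [Finset.mem_insert]
    constructor
    · rintro (h | h | h | h)
      · have := this.1 (Or.inl h); omega
      · omega
      · omega
      · have := this.1 (Or.inr h); omega
    · intro hx
      by_cases hx' : x < 2 * (c + h + k)
      · rcases this.2 ⟨hx.1, hx'⟩ with h | h
        · exact Or.inl h
        · exact Or.inr (Or.inr (Or.inr h))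
      · right; omega
  · simp only [Finset.mem_insert, not_or]
    refine ⟨?_, ?_, H.disjoint x hx⟩
    · rintro rfl; exact n1.1 hx
    · rintro rfl; exact n2.1 hx
  · have h1 := hy _ (Finset.mem_insert_self _ _)
    have h2 := hy _ (Finset.mem_insert_of_mem (Finset.mem_insert_self _ _))
    rw [pairSwap_two_mul] at h1
    rw [pairSwap_two_mul_add_one] at h2
    refine prod_insert_insert_pos ?_ n2.2
      (Or.inr ⟨pairSwap_two_mul _, pairSwap_two_mul_add_one _⟩) h2 h1 (H.dual_pos y fun i hi =>
        hy i (Finset.mem_insert_of_mem (Finset.mem_insert_of_mem hi)))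
    rw [Finset.mem_insert, not_or]
    exact ⟨by omega, n1.2⟩

theorem vertical (H : IsPathFacet c h k S R) :
    IsPathFacet c h (k + 1) (insert (2 * (c + h + k)) (insert (2 * (c + h + k) + 1) S)) R := by
  have n1 := H.notMem_of_le (x := 2 * (c + h + k)) le_rfl
  have n2 := H.notMem_of_le (x := 2 * (c + h + k) + 1) (by omega)
  have n3 : 2 * (c + h + k) ∉ insert (2 * (c + h + k) + 1) S := by
    rw [Finset.mem_insert, not_or]
    exact ⟨by omega, n1.1⟩
  refine ⟨fun x => ?_, fun x hx => ?_, ?_, fun hs => ?_, fun x hx => ?_, H.dual_pos⟩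
  · have := H.mem_or_mem x
    simp only [Finset.mem_insert]
    constructor
    · rintro ((h | h | h) | h)
      · omega
      · omega
      · have := this.1 (Or.inl h); omega
      · have := this.1 (Or.inr h); omega
    · intro hx
      by_cases hx' : x < 2 * (c + h + k)
      · rcases this.2 ⟨hx.1, hx'⟩ with h | h
        · exact Or.inl (Or.inr (Or.inr h))
        · exact Or.inr h
      · left; omega
  · simp only [Finset.mem_insert] at hx
    rcases hx with rfl | rfl | hx
    · exact n1.2
    · exact n2.2
    · exact H.disjoint x hx
  · rw [Finset.card_insert_of_notMem n3, Finset.card_insert_of_notMem n2.1, H.card]; ring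
  · simp only [Finset.mem_insert] at hs ⊢
    rcases hs with h | h | h
    · omega
    · omega
    · exact Or.inr (Or.inr (H.start h))
  · simp only [Finset.mem_insert, not_or] at hx
    exact prod_insert_insert_pos (f := fun i => i) n3 n2.1 (Or.inl ⟨rfl, rfl⟩) hx.1 hx.2.1
      (H.pos x hx.2.2)

/-- Of the four nodes in two new columns, `S` takes the inner two and `R` the outer two, which
`pairSwap` moves to the inner places. -/
theorem diagonal (H : IsPathFacet c h k S R) :
    IsPathFacet c (h + 1) (k + 1)
      (insert (2 * (c + h + k) + 1) (insert (2 * (c + h + k + 1)) S))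
      (insert (2 * (c + h + k)) (insert (2 * (c + h + k + 1) + 1) R)) := by
  have n1 := H.notMem_of_le (x := 2 * (c + h + k)) le_rfl
  have n2 := H.notMem_of_le (x := 2 * (c + h + k) + 1) (by omega)
  have n3 := H.notMem_of_le (x := 2 * (c + h + k + 1)) (by omega)
  have n4 := H.notMem_of_le (x := 2 * (c + h + k + 1) + 1) (by omega)
  have n5 : 2 * (c + h + k) + 1 ∉ insert (2 * (c + h + k + 1)) S := by
    rw [Finset.mem_insert, not_or]
    exact ⟨by omega, n2.1⟩
  refine ⟨fun x => ?_, fun x hx => ?_, ?_, fun hs => ?_, fun x hx => ?_, fun y hy => ?_⟩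
  · have := H.mem_or_mem x
    simp only [Finset.mem_insert]
    constructor
    · rintro ((h | h | h) | (h | h | h))
      · omega
      · omega
      · have := this.1 (Or.inl h); omega
      · omega
      · omega
      · have := this.1 (Or.inr h); omega
    · intro hx
      by_cases hx' : x < 2 * (c + h + k)
      · rcases this.2 ⟨hx.1, hx'⟩ with h | h
        · exact Or.inl (Or.inr (Or.inr h))
        · exact Or.inr (Or.inr (Or.inr h))
      · omega
  · simp only [Finset.mem_insert] at hx
    simp only [Finset.mem_insert, not_or]
    rcases hx with rfl | rfl | hx
    · exact ⟨by omega, by omega, n2.2⟩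
    · exact ⟨by omega, by omega, n3.2⟩
    · refine ⟨?_, ?_, H.disjoint x hx⟩
      · rintro rfl; exact n1.1 hx
      · rintro rfl; exact n4.1 hx
  · rw [Finset.card_insert_of_notMem n5, Finset.card_insert_of_notMem n3.1, H.card]; ring
  · simp only [Finset.mem_insert] at hs ⊢
    rcases hs with h | h | h
    · omega
    · omega
    · exact Or.inr (Or.inr (H.start h))
  · simp only [Finset.mem_insert, not_or] at hx
    exact prod_insert_insert_pos (f := fun i => i) n5 n3.1
      (Or.inl ⟨rfl, show 2 * (c + h + k + 1) = _ by omega⟩)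
      hx.1 (by omega) (H.pos x hx.2.2)
  · have h1 := hy _ (Finset.mem_insert_self _ _)
    have h2 := hy _ (Finset.mem_insert_of_mem (Finset.mem_insert_self _ _))
    rw [pairSwap_two_mul] at h1
    rw [pairSwap_two_mul_add_one] at h2
    refine prod_insert_insert_pos (t := 2 * (c + h + k) + 1) ?_ n4.2
      (Or.inl ⟨pairSwap_two_mul _, by rw [pairSwap_two_mul_add_one]; omega⟩) h1
      (by omega) (H.dual_pos y fun i hi =>
        hy i (Finset.mem_insert_of_mem (Finset.mem_insert_of_mem hi)))
    rw [Finset.mem_insert, not_or]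
    exact ⟨by omega, n1.2⟩

end IsPathFacet

theorem card_image_insert_insert {A : Finset (Finset ℕ)} {a b : ℕ}
    (hA : ∀ S ∈ A, a ∉ S ∧ b ∉ S) :
    (A.image fun S => insert a (insert b S)).card = A.card := by
  refine Finset.card_image_of_injOn fun S hS S' hS' h => ?_
  have h1 := hA S hS
  have h2 := hA S' hS'
  ext x
  have h3 := Finset.ext_iff.1 h x
  simp only [Finset.mem_insert] at h3
  by_cases hxa : x = a
  · rw [hxa]; simp [h1.1, h2.1]
  · by_cases hxb : x = b
    · rw [hxb]; simp [h1.2, h2.2]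
    · simpa [hxa, hxb] using h3

/-- The last step realises the Delannoy recursion. The three kinds are told apart by the last
column, of which `S` contains nothing, everything, or only the smaller element. -/
theorem exists_isPathFacet_card (c : ℕ) : ∀ h k : ℕ, ∃ A : Finset (Finset ℕ),
    A.card = delannoy h k ∧ ∀ S ∈ A, ∃ R, IsPathFacet c h k S R
  | 0, 0 => ⟨{∅}, by simp [delannoy], fun S hS =>
      ⟨∅, by rw [Finset.mem_singleton.1 hS]; exact IsPathFacet.nil c⟩⟩
  | h + 1, 0 => by
      obtain ⟨A, hA, hA'⟩ := exists_isPathFacet_card c h 0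
      refine ⟨A, by rw [hA, delannoy_zero_right, delannoy_zero_right], fun S hS => ?_⟩
      obtain ⟨R, hR⟩ := hA' S hS
      exact ⟨_, hR.horizontal⟩
  | 0, k + 1 => by
      obtain ⟨A, hA, hA'⟩ := exists_isPathFacet_card c 0 k
      refine ⟨A.image fun S => insert (2 * (c + 0 + k)) (insert (2 * (c + 0 + k) + 1) S), ?_,
        fun S hS => ?_⟩
      · rw [card_image_insert_insert, hA, delannoy_zero_left, delannoy_zero_left]
        intro S hS
        obtain ⟨R, hR⟩ := hA' S hS
        exact ⟨(hR.notMem_of_le le_rfl).1, (hR.notMem_of_le (by omega)).1⟩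
      · obtain ⟨S₀, hS₀, rfl⟩ := Finset.mem_image.1 hS
        obtain ⟨R, hR⟩ := hA' S₀ hS₀
        exact ⟨_, hR.vertical⟩
  | h + 1, k + 1 => by
      obtain ⟨A₁, hA₁, hA₁'⟩ := exists_isPathFacet_card c h (k + 1)
      obtain ⟨A₂, hA₂, hA₂'⟩ := exists_isPathFacet_card c (h + 1) k
      obtain ⟨A₃, hA₃, hA₃'⟩ := exists_isPathFacet_card c h k
      have e₁ : ∀ S ∈ A₁, ∀ x, 2 * (c + h + k + 1) ≤ x → x ∉ S := fun S hS x hx => by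
        obtain ⟨R, hR⟩ := hA₁' S hS
        exact (hR.notMem_of_le (by omega)).1
      have e₂ : ∀ S ∈ A₂, ∀ x, 2 * (c + h + k + 1) ≤ x → x ∉ S := fun S hS x hx => by
        obtain ⟨R, hR⟩ := hA₂' S hS
        exact (hR.notMem_of_le (by omega)).1
      have e₃ : ∀ S ∈ A₃, ∀ x, 2 * (c + h + k) ≤ x → x ∉ S := fun S hS x hx => by
        obtain ⟨R, hR⟩ := hA₃' S hS
        exact (hR.notMem_of_le (by omega)).1
      refine ⟨A₁ ∪ (A₂.image fun S => insert (2 * (c + (h + 1) + k))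
          (insert (2 * (c + (h + 1) + k) + 1) S)) ∪
        A₃.image fun S => insert (2 * (c + h + k) + 1) (insert (2 * (c + h + k + 1)) S), ?_, ?_⟩
      · rw [Finset.card_union_of_disjoint, Finset.card_union_of_disjoint,
          card_image_insert_insert, card_image_insert_insert, hA₁, hA₂, hA₃, delannoy_succ_succ]
        · exact fun S hS => ⟨e₃ S hS _ (by omega), e₃ S hS _ (by omega)⟩
        · exact fun S hS => ⟨e₂ S hS _ (by omega), e₂ S hS _ (by omega)⟩
        · rw [Finset.disjoint_left]
          intro S hS hS'
          obtain ⟨S₀, hS₀, rfl⟩ := Finset.mem_image.1 hS'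
          exact e₁ _ hS _ (by omega) (Finset.mem_insert_self _ _)
        · rw [Finset.disjoint_left]
          intro S hS hS'
          obtain ⟨S₀, hS₀, rfl⟩ := Finset.mem_image.1 hS'
          rcases Finset.mem_union.1 hS with hS | hS
          · exact e₁ _ hS _ (by omega) (Finset.mem_insert_of_mem (Finset.mem_insert_self _ _))
          · obtain ⟨S'', hS'', heq⟩ := Finset.mem_image.1 hS
            have h1 := Finset.ext_iff.1 heq (2 * (c + h + k + 1) + 1)
            simp only [Finset.mem_insert, e₃ S₀ hS₀ (2 * (c + h + k + 1) + 1) (by omega),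
              or_false] at h1
            have := h1.1 (Or.inr (Or.inl (by omega)))
            omega
      · intro S hS
        rcases Finset.mem_union.1 hS with hS | hS
        · rcases Finset.mem_union.1 hS with hS | hS
          · obtain ⟨R, hR⟩ := hA₁' S hS
            exact ⟨_, hR.horizontal⟩
          · obtain ⟨S₀, hS₀, rfl⟩ := Finset.mem_image.1 hS
            obtain ⟨R, hR⟩ := hA₂' S₀ hS₀
            exact ⟨_, hR.vertical⟩
        · obtain ⟨S₀, hS₀, rfl⟩ := Finset.mem_image.1 hS
          obtain ⟨R, hR⟩ := hA₃' S₀ hS₀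
          exact ⟨_, hR.diagonal⟩

/-! ### Counting paired facets -/

open Classical in
/-- The sets of `2 * k` vertices that form a facet of the cyclic polytope with nodes
`0, …, 2 * m - 1` and whose complement forms a facet of the cyclic polytope with the nodes
permuted by `pairSwap`. -/
noncomputable def pairedFacets (m k : ℕ) : Finset (Finset ℕ) :=
  ((Finset.range (2 * m)).powersetCard (2 * k)).filter fun S =>
    IsCyclicFacet (fun x : ℕ => (x : ℝ)) (Finset.range (2 * m)) S ∧
    IsCyclicFacet (fun x : ℕ => (pairSwap x : ℝ)) (Finset.range (2 * m)) (Finset.range (2 * m) \ S)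

theorem mem_pairedFacets {m k : ℕ} {S : Finset ℕ} : S ∈ pairedFacets m k ↔
    (S ⊆ Finset.range (2 * m) ∧ S.card = 2 * k) ∧
    IsCyclicFacet (fun x : ℕ => (x : ℝ)) (Finset.range (2 * m)) S ∧
    IsCyclicFacet (fun x : ℕ => (pairSwap x : ℝ)) (Finset.range (2 * m))
      (Finset.range (2 * m) \ S) := by
  simp only [pairedFacets, Finset.mem_filter, Finset.mem_powersetCard]

theorem pairSwap_lt {m x : ℕ} (h : x < 2 * m) : pairSwap x < 2 * m := by
  unfold pairSwap; split_ifs <;> omega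

theorem IsPathFacet.mem_pairedFacets {h k : ℕ} {S R : Finset ℕ} (H : IsPathFacet 0 h k S R) :
    S ∈ pairedFacets (h + k) k := by
  have hmem := H.mem_or_mem
  have hsub : S ⊆ Finset.range (2 * (h + k)) := fun x hx => by
    have := (hmem x).1 (Or.inl hx)
    rw [Finset.mem_range]; omega
  have hR : Finset.range (2 * (h + k)) \ S = R := by
    ext x
    rw [Finset.mem_sdiff, Finset.mem_range]
    constructor
    · rintro ⟨hx, hxS⟩
      exact ((hmem x).2 ⟨by omega, by omega⟩).resolve_left hxS
    · intro hx
      have := (hmem x).1 (Or.inr hx)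
      exact ⟨by omega, fun hxS => H.disjoint x hxS hx⟩
  refine _root_.mem_pairedFacets.2 ⟨⟨hsub, H.card⟩, ⟨1, fun j hj => ?_⟩, ⟨1, fun j hj => ?_⟩⟩
  · rw [one_mul]
    exact H.pos j (Finset.mem_sdiff.1 hj).2
  · rw [Finset.sdiff_sdiff_eq_self hsub] at hj
    rw [one_mul, hR]
    refine H.dual_pos _ fun i hi hij => ?_
    rw [pairSwap_injective hij] at hj
    exact H.disjoint i hj hi

/-- A diagonal step closes the path from the last column to the first. Both `S` and the swapped
complement gain the two extreme nodes, whose factor is negative in between; hence the sign `-1`. -/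
theorem IsPathFacet.insert_mem_pairedFacets {h k : ℕ} {S R : Finset ℕ}
    (H : IsPathFacet 1 h k S R) :
    insert 0 (insert (2 * (h + k + 1) + 1) S) ∈ pairedFacets (h + k + 2) (k + 1) := by
  have hmem := H.mem_or_mem
  have n0 := H.notMem_of_lt (x := 0) (by omega)
  have n1 := H.notMem_of_lt (x := 1) (by omega)
  have n2 := H.notMem_of_le (x := 2 * (h + k + 1)) (by omega)
  have n3 := H.notMem_of_le (x := 2 * (h + k + 1) + 1) (by omega)
  have n4 : 0 ∉ insert (2 * (h + k + 1) + 1) S := by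
    rw [Finset.mem_insert, not_or]; exact ⟨by omega, n0.1⟩
  have n5 : 1 ∉ insert (2 * (h + k + 1)) R := by
    rw [Finset.mem_insert, not_or]; exact ⟨by omega, n1.2⟩
  have hsub : insert 0 (insert (2 * (h + k + 1) + 1) S) ⊆ Finset.range (2 * (h + k + 2)) := by
    intro x hx
    simp only [Finset.mem_insert] at hx
    rw [Finset.mem_range]
    rcases hx with hx | hx | hx
    · omega
    · omega
    · have := (hmem x).1 (Or.inl hx); omega
  have hR : Finset.range (2 * (h + k + 2)) \ insert 0 (insert (2 * (h + k + 1) + 1) S) =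
      insert 1 (insert (2 * (h + k + 1)) R) := by
    ext x
    simp only [Finset.mem_sdiff, Finset.mem_range, Finset.mem_insert, not_or]
    constructor
    · rintro ⟨hx, hx0, hx1, hxS⟩
      by_cases h1 : x = 1
      · exact Or.inl h1
      · by_cases h2 : x = 2 * (h + k + 1)
        · exact Or.inr (Or.inl h2)
        · exact Or.inr (Or.inr (((hmem x).2 ⟨by omega, by omega⟩).resolve_left hxS))
    · rintro (rfl | rfl | hx)
      · exact ⟨by omega, by omega, by omega, n1.1⟩
      · exact ⟨by omega, by omega, by omega, n2.1⟩
      · have := (hmem x).1 (Or.inr hx)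
        exact ⟨by omega, by omega, by omega, fun hxS => H.disjoint x hxS hx⟩
  have hneg : ∀ x : ℕ, x < 2 * (h + k + 2) → x ≠ 0 → x ≠ 2 * (h + k + 1) + 1 →
      0 < -(((x : ℝ) - (0 : ℕ)) * ((x : ℝ) - (2 * (h + k + 1) + 1 : ℕ))) := by
    intro x hx h0 h1
    have h2 : (0 : ℝ) < x := by exact_mod_cast Nat.pos_of_ne_zero h0
    have h3 : (x : ℝ) < (2 * (h + k + 1) + 1 : ℕ) := by exact_mod_cast (by omega)
    rw [Nat.cast_zero, sub_zero]
    nlinarith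
  refine _root_.mem_pairedFacets.2 ⟨⟨hsub, ?_⟩, ⟨-1, fun j hj => ?_⟩, ⟨-1, fun j hj => ?_⟩⟩
  · rw [Finset.card_insert_of_notMem n4, Finset.card_insert_of_notMem n3.1, H.card]; ring
  · simp only [Finset.mem_sdiff, Finset.mem_range, Finset.mem_insert, not_or] at hj
    rw [Finset.prod_insert n4, Finset.prod_insert n3.1]
    have := mul_pos (hneg j hj.1 hj.2.1 hj.2.2.1) (H.pos j hj.2.2.2)
    linarith
  · rw [Finset.sdiff_sdiff_eq_self hsub] at hj
    have hjR : j ∉ insert 1 (insert (2 * (h + k + 1)) R) := by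
      rw [← hR, Finset.mem_sdiff]
      exact fun hj' => hj'.2 hj
    simp only [Finset.mem_insert, not_or] at hjR
    have hj2 := pairSwap_lt (Finset.mem_range.1 (hsub hj))
    have s1 : pairSwap 1 = 0 := pairSwap_two_mul_add_one 0
    have s2 := pairSwap_two_mul (h + k + 1)
    rw [hR, Finset.prod_insert n5, Finset.prod_insert n2.2]
    beta_reduce
    rw [s1, s2]
    have h0 : pairSwap j ≠ 0 := fun h0 => hjR.1 (pairSwap_injective (h0.trans s1.symm))
    have h1 : pairSwap j ≠ 2 * (h + k + 1) + 1 :=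
      fun h1 => hjR.2.1 (pairSwap_injective (h1.trans s2.symm))
    have := mul_pos (hneg _ hj2 h0 h1) (H.dual_pos (pairSwap j) fun i hi hij => by
      rw [pairSwap_injective hij] at hjR
      exact hjR.2.2 hi)
    linarith

theorem delannoyF_zero_right (h : ℕ) : delannoyF h 0 = 1 := by
  cases h <;> exact delannoy_zero_right _

theorem delannoyF_zero_left (k : ℕ) : delannoyF 0 k = 1 := by
  cases k <;> exact delannoy_zero_left _

theorem delannoyF_succ_succ (h k : ℕ) :
    delannoyF (h + 1) (k + 1) = delannoy (h + 1) (k + 1) + delannoy h k := rfl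

theorem delannoy_comm (h k : ℕ) : delannoy h k = delannoy k h := by
  rw [delannoy, delannoy, min_comm]
  exact Finset.sum_congr rfl fun l _ => by ring

theorem delannoyF_comm (h k : ℕ) : delannoyF h k = delannoyF k h := by
  cases h with
  | zero => rw [delannoyF_zero_left, delannoyF_zero_right]
  | succ h =>
    cases k with
    | zero => rw [delannoyF_zero_left, delannoyF_zero_right]
    | succ k => rw [delannoyF_succ_succ, delannoyF_succ_succ, delannoy_comm, delannoy_comm h k]

theorem delannoy_le_delannoyF (h k : ℕ) : delannoy h k ≤ delannoyF h k := by
  cases h with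
  | zero => rw [delannoyF_zero_left, delannoy_zero_left]
  | succ h =>
    cases k with
    | zero => rw [delannoyF_zero_right, delannoy_zero_right]
    | succ k => rw [delannoyF_succ_succ]; exact Nat.le_add_right _ _

/-- The two families are disjoint: a closed-up path contains `0` without `1`, which
`IsPathFacet.start` excludes for an ordinary one. -/
theorem delannoyF_le_card_pairedFacets (h k : ℕ) :
    delannoyF h k ≤ (pairedFacets (h + k) k).card := by
  obtain ⟨A, hA, hA'⟩ := exists_isPathFacet_card 0 h k
  have hsub : A ⊆ pairedFacets (h + k) k := fun S hS => by
    obtain ⟨R, hR⟩ := hA' S hS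
    exact hR.mem_pairedFacets
  cases h with
  | zero =>
    rw [delannoyF_zero_left, ← delannoy_zero_left k]
    exact hA.ge.trans (Finset.card_le_card hsub)
  | succ h =>
    cases k with
    | zero =>
      rw [delannoyF_zero_right, ← delannoy_zero_right (h + 1)]
      exact hA.ge.trans (Finset.card_le_card hsub)
    | succ k =>
      obtain ⟨B, hB, hB'⟩ := exists_isPathFacet_card 1 h k
      have hmk : h + 1 + (k + 1) = h + k + 2 := by ring
      have hsub' : (B.image fun S => insert 0 (insert (2 * (h + k + 1) + 1) S)) ⊆
          pairedFacets (h + 1 + (k + 1)) (k + 1) := fun S hS => by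
        obtain ⟨S₀, hS₀, rfl⟩ := Finset.mem_image.1 hS
        obtain ⟨R, hR⟩ := hB' S₀ hS₀
        rw [hmk]
        exact hR.insert_mem_pairedFacets
      have hdisj : Disjoint A (B.image fun S => insert 0 (insert (2 * (h + k + 1) + 1) S)) := by
        rw [Finset.disjoint_left]
        intro S hSA hSB
        obtain ⟨S₀, hS₀, rfl⟩ := Finset.mem_image.1 hSB
        obtain ⟨R, hR⟩ := hA' _ hSA
        obtain ⟨R', hR'⟩ := hB' S₀ hS₀
        have h1 := hR.start (Finset.mem_insert_self _ _)
        simp only [Finset.mem_insert, (hR'.notMem_of_lt (x := 2 * 0 + 1) (by omega)).1,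
          or_false] at h1
        omega
      rw [delannoyF_succ_succ, ← hA, ← hB, ← card_image_insert_insert (A := B) (a := 0)
        (b := 2 * (h + k + 1) + 1), ← Finset.card_union_of_disjoint hdisj]
      · exact Finset.card_le_card (Finset.union_subset hsub hsub')
      · intro S hS
        obtain ⟨R, hR⟩ := hB' S hS
        exact ⟨(hR.notMem_of_lt (by omega)).1, (hR.notMem_of_le (by omega)).1⟩

/-! ### Facets that are not paired -/

theorem prod_Ico_sub_pos (a n : ℕ) {x : ℕ} (hx : x < a ∨ a + 2 * n ≤ x) :
    0 < ∏ i ∈ Finset.Ico a (a + 2 * n), ((x : ℝ) - i) := by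
  induction n with
  | zero => simp
  | succ n ih =>
    rw [show a + 2 * (n + 1) = a + 2 * n + 1 + 1 by ring,
      Finset.prod_Ico_succ_top (by omega), Finset.prod_Ico_succ_top (by omega), mul_assoc]
    exact mul_pos (ih (by omega)) (sub_mul_sub_add_one_pos (by omega) (by omega))

/-- After the swap, the complement has exactly the node `2 * i + 1` between `2 * i` and `2 * i + 2`,
so its nodal product takes opposite signs at two nodes where the signs should agree. -/
theorem notMem_pairedFacets {m k i : ℕ} {S : Finset ℕ} (h0 : 2 * i ∉ S) (h1 : 2 * i + 1 ∈ S)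
    (h3 : 2 * i + 3 ∈ S) : S ∉ pairedFacets m k := by
  intro hS
  obtain ⟨⟨hsub, -⟩, -, σ, hσ⟩ := mem_pairedFacets.1 hS
  rw [Finset.sdiff_sdiff_eq_self hsub] at hσ
  have p1 := hσ _ h1
  have p3 := hσ _ h3
  have s1 := pairSwap_two_mul_add_one i
  have s3 : pairSwap (2 * i + 3) = 2 * i + 2 := pairSwap_two_mul_add_one (i + 1)
  have s0 := pairSwap_two_mul i
  simp only [s1, s3] at p1 p3
  have h0' : 2 * i ∈ Finset.range (2 * m) \ S := by
    have := Finset.mem_range.1 (hsub h1)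
    rw [Finset.mem_sdiff, Finset.mem_range]
    exact ⟨by omega, h0⟩
  have hprod : ∏ t ∈ Finset.range (2 * m) \ S,
      (((2 * i : ℕ) : ℝ) - pairSwap t) * (((2 * i + 2 : ℕ) : ℝ) - pairSwap t) < 0 := by
    rw [← Finset.mul_prod_erase _ _ h0', s0]
    refine mul_neg_of_neg_of_pos (by push_cast; norm_num) (Finset.prod_pos fun t ht => ?_)
    rw [Finset.mem_erase, Finset.mem_sdiff] at ht
    have e0 : pairSwap t ≠ 2 * i + 1 := fun h => ht.1 (pairSwap_injective (h.trans s0.symm))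
    have e1 : pairSwap t ≠ 2 * i := fun h =>
      ht.2.2 (by rw [pairSwap_injective (h.trans s1.symm)]; exact h1)
    have e3 : pairSwap t ≠ 2 * i + 2 := fun h =>
      ht.2.2 (by rw [pairSwap_injective (h.trans s3.symm)]; exact h3)
    rcases lt_or_gt_of_ne e1 with h | h
    · have : (pairSwap t : ℝ) < (2 * i : ℕ) := by exact_mod_cast h
      push_cast at this ⊢
      nlinarith
    · have : ((2 * i + 2 : ℕ) : ℝ) < pairSwap t := by exact_mod_cast (by omega)
      push_cast at this ⊢
      nlinarith
  rw [Finset.prod_mul_distrib] at hprod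
  nlinarith [mul_pos p1 p3, sq_nonneg σ]

/-- Facets of the cyclic polytope through a given vertex that are not paired. -/
theorem exists_isCyclicFacet_notMem_pairedFacets {h k v : ℕ} (hh : 0 < h) (hk : 1 < k)
    (hv : v < 2 * (h + k)) :
    ∃ G ⊆ Finset.range (2 * (h + k)), v ∈ G ∧ G.card = 2 * k ∧
      IsCyclicFacet (fun x : ℕ => (x : ℝ)) (Finset.range (2 * (h + k))) G ∧
      G ∉ pairedFacets (h + k) k := by
  -- The extreme nodes lie on a facet joining `0` to a final interval; any other node lies in an
  -- interval of length `2 * k` with odd start.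
  by_cases hv' : v = 0 ∨ v = 2 * (h + k) - 1
  · have hlast : 2 * (h + k) = 2 * h + 1 + 2 * (k - 1) + 1 := by omega
    have n0 : 0 ∉ Finset.Ico (2 * h + 1) (2 * (h + k)) := by simp
    refine ⟨insert 0 (Finset.Ico (2 * h + 1) (2 * (h + k))), fun x hx => ?_, ?_, ?_,
      ⟨-1, fun j hj => ?_⟩, ?_⟩
    · rw [Finset.mem_insert, Finset.mem_Ico] at hx
      rw [Finset.mem_range]; omega
    · rw [Finset.mem_insert, Finset.mem_Ico]; omega
    · rw [Finset.card_insert_of_notMem n0, Nat.card_Ico]; omega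
    · simp only [Finset.mem_sdiff, Finset.mem_range, Finset.mem_insert, not_or,
        Finset.mem_Ico] at hj
      rw [Finset.prod_insert n0, hlast, Finset.prod_Ico_succ_top (by omega)]
      have h1 := prod_Ico_sub_pos (2 * h + 1) (k - 1) (x := j) (by omega)
      have h2 : (0 : ℝ) < j := by exact_mod_cast Nat.pos_of_ne_zero hj.2.1
      have h3 : (j : ℝ) < (2 * h + 1 + 2 * (k - 1) : ℕ) := by exact_mod_cast (by omega)
      have h4 := mul_pos (mul_pos h2 (sub_pos.2 h3)) h1
      beta_reduce
      rw [Nat.cast_zero, sub_zero]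
      linarith
    · refine notMem_pairedFacets (i := h) ?_ ?_ ?_ <;>
        rw [Finset.mem_insert, Finset.mem_Ico] <;> omega
  · obtain ⟨i, hi, hi1, hi2⟩ : ∃ i < h, 2 * i + 1 ≤ v ∧ v ≤ 2 * i + 2 * k := by
      by_cases hvh : (v - 1) / 2 < h
      · exact ⟨(v - 1) / 2, hvh, by omega, by omega⟩
      · exact ⟨h - 1, by omega, by omega, by omega⟩
    refine ⟨Finset.Ico (2 * i + 1) (2 * i + 1 + 2 * k), fun x hx => ?_, ?_, ?_,
      ⟨1, fun j hj => ?_⟩, ?_⟩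
    · rw [Finset.mem_Ico] at hx
      rw [Finset.mem_range]; omega
    · rw [Finset.mem_Ico]; omega
    · rw [Nat.card_Ico]; omega
    · rw [Finset.mem_sdiff, Finset.mem_Ico] at hj
      rw [one_mul]
      exact prod_Ico_sub_pos _ _ (by omega)
    · refine notMem_pairedFacets (i := i) ?_ ?_ ?_ <;> rw [Finset.mem_Ico] <;> omega

/-! ### Averaging, vertex deletion and vertex figures -/

/-- Double counting of incidences: some vertex does at least as well as the average. -/
theorem exists_mul_card_le {Γ : Finset (Finset ℕ)} {n r : ℕ} (hn : 0 < n)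
    (hsub : ∀ S ∈ Γ, S ⊆ Finset.range n) (hcard : ∀ S ∈ Γ, S.card = r) :
    (∃ v < n, r * Γ.card ≤ n * (Γ.filter fun S => v ∈ S).card) ∧
      ∃ v < n, (n - r) * Γ.card ≤ n * (Γ.filter fun S => v ∉ S).card := by
  have hne : (Finset.range n).Nonempty := ⟨0, Finset.mem_range.2 hn⟩
  have aux : ∀ (P : ℕ → Finset ℕ → Prop) [∀ v S, Decidable (P v S)] (a : ℕ),
      (∀ S ∈ Γ, ((Finset.range n).filter fun v => P v S).card = a) →
      ∃ v < n, a * Γ.card ≤ n * (Γ.filter fun S => P v S).card := by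
    intro P _ a ha
    have h1 : ∑ v ∈ Finset.range n, (Γ.filter fun S => P v S).card = a * Γ.card := by
      simp only [Finset.card_filter]
      rw [Finset.sum_comm]
      simp only [← Finset.card_filter]
      rw [Finset.sum_congr rfl ha, Finset.sum_const, smul_eq_mul, mul_comm]
    obtain ⟨v, hv, hle⟩ := Finset.exists_le_of_sum_le (s := Finset.range n)
      (f := fun _ => a * Γ.card) (g := fun v => n * (Γ.filter fun S => P v S).card) hne
      (by simp only [← Finset.mul_sum, h1, Finset.sum_const, Finset.card_range, smul_eq_mul]
          exact (mul_left_comm a n _).le)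
    exact ⟨v, Finset.mem_range.1 hv, hle⟩
  refine ⟨aux (fun v S => v ∈ S) r fun S hS => ?_, aux (fun v S => v ∉ S) (n - r) fun S hS => ?_⟩
  · rw [Finset.filter_mem_eq_inter, Finset.inter_eq_right.2 (hsub S hS), hcard S hS]
  · rw [← Finset.sdiff_eq_filter, Finset.card_sdiff_of_subset (hsub S hS), hcard S hS,
      Finset.card_range]

theorem isPositivelyDecorated_of_isCyclicFacet {ι : Type*} [DecidableEq ι] {d k : ℕ}
    (J : Finset ι) (hJ : J.card = d + k + 1) (τ : ι → ℝ) (hτ : Set.InjOn τ J) :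
    ∃ C : Fin d → ι → ℝ, ∀ S ⊆ J, S.card = d + 1 → IsCyclicFacet τ J (J \ S) →
      IsPositivelyDecorated C S := by
  obtain ⟨C, hC⟩ := exists_coefficients J hJ τ hτ
  refine ⟨C, fun S hS hcard hfac => hC S hS hcard ?_⟩
  obtain ⟨σ, hσ⟩ := hfac
  rw [Finset.sdiff_sdiff_eq_self hS] at hσ
  exact ⟨σ, hσ⟩

theorem natCast_mem_fieldRange (n : ℕ) : (n : ℝ) ∈ (algebraMap ℚ ℝ).fieldRange :=
  natCast_mem _ n

theorem pairSwap_cast_injective : Function.Injective fun x : ℕ => (pairSwap x : ℝ) :=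
  Nat.cast_injective.comp pairSwap_injective

/-- Coefficients and lifting are built on all nodes; only then are the monomials restricted to `J`,
which keeps the faces contained in `J`. -/
theorem card_filter_pairedFacets_le_Xi {h k e : ℕ} (hh : 0 < h) (hk : 1 < k) (J : Finset ℕ)
    (hJ : J ⊆ Finset.range (2 * (h + k))) (hcard : J.card ≤ 2 * k + e) :
    (((pairedFacets (h + k) k).filter fun S => S ⊆ J).card : ℕ∞) ≤ Xi (2 * k - 1) e := by
  obtain ⟨C, hC⟩ := isPositivelyDecorated_of_isCyclicFacet (d := 2 * k - 1) (k := 2 * h)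
    (Finset.range (2 * (h + k))) (by rw [Finset.card_range]; omega)
    (fun x : ℕ => (pairSwap x : ℝ)) pairSwap_cast_injective.injOn
  -- Any unpaired facet will do here; the vertex `0` is arbitrary.
  obtain ⟨G, hG, -, hGcard, hGfac, hGnot⟩ :=
    exists_isCyclicFacet_notMem_pairedFacets (v := 0) hh hk (by omega)
  refine card_le_Xi_of_isCyclicFacet (Finset.range (2 * (h + k))) J hJ (by omega)
    (fun x : ℕ => (x : ℝ)) Nat.cast_injective.injOn (fun j _ => natCast_mem_fieldRange j)
    (by rw [Finset.card_range]; omega) G hG (by omega) hGfac C _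
    (fun hmem => hGnot (Finset.mem_filter.1 hmem).1) (fun S hS => (Finset.mem_filter.1 hS).2)
    (fun S hS => ?_) (fun S hS => ?_) (fun S hS => ?_)
  all_goals
    obtain ⟨⟨hS1, hS2⟩, hS3, hS4⟩ := mem_pairedFacets.1 (Finset.mem_filter.1 hS).1
  · omega
  · exact hS3
  · exact hC S hS1 (by omega) hS4

theorem delannoyF_le_Xi {h k : ℕ} (hh : 0 < h) (hk : 1 < k) :
    (delannoyF h k : ℕ∞) ≤ Xi (2 * k - 1) (2 * h) := by
  refine le_trans ?_ (card_filter_pairedFacets_le_Xi hh hk (Finset.range (2 * (h + k)))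
    subset_rfl (by rw [Finset.card_range]; omega))
  rw [Finset.filter_true_of_mem fun S hS => (mem_pairedFacets.1 hS).1.1]
  exact_mod_cast delannoyF_le_card_pairedFacets h k

theorem exists_delannoyF_mul_le_of_notMem {h k : ℕ} (hh : 0 < h) (hk : 1 < k) :
    ∃ N : ℕ, (N : ℕ∞) ≤ Xi (2 * k - 1) (2 * h - 1) ∧ h * delannoyF h k ≤ (h + k) * N := by
  obtain ⟨-, v, hv, hle⟩ := exists_mul_card_le (Γ := pairedFacets (h + k) k) (n := 2 * (h + k))
    (r := 2 * k) (by omega) (fun S hS => (mem_pairedFacets.1 hS).1.1)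
    (fun S hS => (mem_pairedFacets.1 hS).1.2)
  have hvr : v ∈ Finset.range (2 * (h + k)) := Finset.mem_range.2 hv
  refine ⟨_, card_filter_pairedFacets_le_Xi (e := 2 * h - 1) hh hk
    ((Finset.range (2 * (h + k))).erase v) (Finset.erase_subset _ _)
    (by rw [Finset.card_erase_of_mem hvr, Finset.card_range]; omega), ?_⟩
  have heq : ((pairedFacets (h + k) k).filter fun S =>
      S ⊆ (Finset.range (2 * (h + k))).erase v) =
      (pairedFacets (h + k) k).filter fun S => v ∉ S := by
    refine Finset.filter_congr fun S hS => ?_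
    rw [Finset.subset_erase]
    exact and_iff_right (mem_pairedFacets.1 hS).1.1
  rw [heq]
  have h1 := Nat.mul_le_mul_left h (delannoyF_le_card_pairedFacets h k)
  rw [show 2 * (h + k) - 2 * k = 2 * h by omega, mul_assoc, mul_assoc] at hle
  exact h1.trans (Nat.le_of_mul_le_mul_left hle two_pos)

/-- Sending `s v` to infinity describes the vertex figure at `v`. An odd number of factors `(s j - s
v)⁻¹` appears, and its sign replaces the missing factor `s j - s v`. -/
theorem IsCyclicFacet.erase {ι : Type*} [DecidableEq ι] {s : ι → ℝ} {J S : Finset ι} {v : ι}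
    {k : ℕ} (h : IsCyclicFacet s J S) (hs : Set.InjOn s J) (hSJ : S ⊆ J) (hv : v ∈ S)
    (hcard : S.card = 2 * k) :
    IsCyclicFacet (fun x => (s x - s v)⁻¹) (J.erase v) (S.erase v) := by
  obtain ⟨σ, hσ⟩ := h
  refine ⟨σ * ∏ i ∈ S.erase v, -(s i - s v)⁻¹, fun j hj => ?_⟩
  rw [Finset.mem_sdiff, Finset.mem_erase, Finset.mem_erase, not_and] at hj
  obtain ⟨⟨hjv, hjJ⟩, hjS⟩ := hj
  have hne : ∀ i ∈ J, i ≠ v → s i - s v ≠ 0 := fun i hi hiv =>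
    sub_ne_zero.2 fun heq => hiv (hs hi (hSJ hv) heq)
  have hj0 := hne j hjJ hjv
  have hsum : ∀ i ∈ S.erase v, (s j - s v)⁻¹ - (s i - s v)⁻¹ =
      (s j - s i) * (-(s i - s v)⁻¹) * (s j - s v)⁻¹ := by
    intro i hi
    rw [Finset.mem_erase] at hi
    have := hne i (hSJ hi.2) hi.1
    field_simp
    ring
  have hpos := hσ j (Finset.mem_sdiff.2 ⟨hjJ, hjS hjv⟩)
  rw [← Finset.mul_prod_erase S _ hv] at hpos
  have hc : ∏ i ∈ S.erase v, -(s i - s v)⁻¹ ≠ 0 := by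
    refine Finset.prod_ne_zero_iff.2 fun i hi => ?_
    rw [Finset.mem_erase] at hi
    exact neg_ne_zero.2 (inv_ne_zero (hne i (hSJ hi.2) hi.1))
  beta_reduce
  rw [Finset.prod_congr rfl hsum, Finset.prod_mul_distrib, Finset.prod_mul_distrib,
    Finset.prod_const]
  have hk : (s j - s v)⁻¹ ^ (S.erase v).card = (s j - s v) * ((s j - s v)⁻¹ ^ k) ^ 2 := by
    have h1 : (S.erase v).card + 1 = 2 * k := by
      rw [Finset.card_erase_add_one hv, hcard]
    rw [← pow_mul, mul_comm k 2, ← h1, pow_succ]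
    field_simp
  rw [hk]
  have h2 : 0 < ((s j - s v)⁻¹ ^ k) ^ 2 :=
    sq_pos_iff.2 (pow_ne_zero _ (inv_ne_zero hj0))
  have h3 : 0 < (∏ i ∈ S.erase v, -(s i - s v)⁻¹) ^ 2 := sq_pos_iff.2 hc
  calc _ < _ := mul_pos (mul_pos hpos h3) h2
    _ = _ := by ring

/-- Erasing `v` from both `S` and the node set leaves the complement unchanged, so the decoration
survives. The unpaired facet must contain `v` in order to pass to the vertex figure. -/
theorem exists_delannoyF_mul_le_of_mem {h k : ℕ} (hh : 0 < h) (hk : 1 < k) :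
    ∃ N : ℕ, (N : ℕ∞) ≤ Xi (2 * k - 2) (2 * h) ∧ k * delannoyF h k ≤ (h + k) * N := by
  obtain ⟨⟨v, hv, hle⟩, -⟩ := exists_mul_card_le (Γ := pairedFacets (h + k) k) (n := 2 * (h + k))
    (r := 2 * k) (by omega) (fun S hS => (mem_pairedFacets.1 hS).1.1)
    (fun S hS => (mem_pairedFacets.1 hS).1.2)
  set J := Finset.range (2 * (h + k)) with hJ
  have hvJ : v ∈ J := Finset.mem_range.2 hv
  have hJcard : (J.erase v).card + 1 = 2 * (h + k) := by
    rw [Finset.card_erase_add_one hvJ, hJ, Finset.card_range]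
  set Γ := (pairedFacets (h + k) k).filter fun S => v ∈ S with hΓ
  have herase : ∀ S S' : Finset ℕ, v ∈ S → v ∈ S' → S.erase v = S'.erase v → S = S' := by
    intro S S' hS hS' heq
    rw [← Finset.insert_erase hS, heq, Finset.insert_erase hS']
  obtain ⟨C, hC⟩ := isPositivelyDecorated_of_isCyclicFacet (d := 2 * k - 2) (k := 2 * h)
    (J.erase v) (by omega) (fun x : ℕ => (pairSwap x : ℝ)) pairSwap_cast_injective.injOn
  obtain ⟨G, hG, hvG, hGcard, hGfac, hGnot⟩ :=
    exists_isCyclicFacet_notMem_pairedFacets hh hk hv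
  have hinj : Set.InjOn (fun x : ℕ => ((x : ℝ) - v)⁻¹) (J.erase v) := by
    intro x _ y _ hxy
    have := inv_injective hxy
    exact_mod_cast sub_left_injective this
  refine ⟨Γ.card, ?_, ?_⟩
  · have hcardΓ : (Γ.image fun S => S.erase v).card = Γ.card :=
      Finset.card_image_of_injOn fun S hS S' hS' heq =>
        herase S S' (Finset.mem_filter.1 hS).2 (Finset.mem_filter.1 hS').2 heq
    rw [← hcardΓ]
    have hdata : ∀ S' ∈ Γ.image fun S => S.erase v, ∃ S, S' = S.erase v ∧ v ∈ S ∧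
        S ∈ pairedFacets (h + k) k := by
      intro S' hS'
      obtain ⟨S, hS, rfl⟩ := Finset.mem_image.1 hS'
      exact ⟨S, rfl, (Finset.mem_filter.1 hS).2, (Finset.mem_filter.1 hS).1⟩
    refine card_le_Xi_of_isCyclicFacet (J.erase v) (J.erase v) subset_rfl (by omega)
      (fun x : ℕ => ((x : ℝ) - v)⁻¹) hinj (fun j _ => ?_) (by omega) (G.erase v)
      (Finset.erase_subset_erase v hG) ?_ (hGfac.erase Nat.cast_injective.injOn hG hvG hGcard) C _
      ?_ (fun S' hS' => ?_) (fun S' hS' => ?_) (fun S' hS' => ?_) (fun S' hS' => ?_)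
    · exact Subfield.inv_mem _ (Subfield.sub_mem _ (natCast_mem_fieldRange j)
        (natCast_mem_fieldRange v))
    · rw [Finset.card_erase_of_mem hvG, hGcard]; omega
    · intro hmem
      obtain ⟨S, hS, hvS, hSΓ⟩ := hdata _ hmem
      exact hGnot (herase G S hvG hvS hS ▸ hSΓ)
    all_goals
      obtain ⟨S, rfl, hvS, hSΓ⟩ := hdata _ hS'
      obtain ⟨⟨hS1, hS2⟩, hS3, hS4⟩ := mem_pairedFacets.1 hSΓ
      have hSc : (S.erase v).card = 2 * k - 2 + 1 := by
        rw [Finset.card_erase_of_mem hvS, hS2]; omega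
    · exact Finset.erase_subset_erase v hS1
    · exact hSc
    · exact hS3.erase Nat.cast_injective.injOn hS1 hvS hS2
    · refine hC _ (Finset.erase_subset_erase v hS1) hSc ?_
      have hcompl : J.erase v \ S.erase v = J \ S := by
        ext x
        simp only [Finset.mem_sdiff, Finset.mem_erase]
        constructor
        · rintro ⟨⟨h1, h2⟩, h3⟩
          exact ⟨h2, fun h4 => h3 ⟨h1, h4⟩⟩
        · rintro ⟨h1, h2⟩
          exact ⟨⟨fun h3 => h2 (h3 ▸ hvS), h1⟩, fun h3 => h2 h3.2⟩
      rw [hcompl]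
      obtain ⟨σ, hσ⟩ := hS4
      refine ⟨σ, fun j hj => hσ j ?_⟩
      rw [Finset.mem_sdiff] at hj ⊢
      exact ⟨Finset.mem_of_mem_erase hj.1, hj.2⟩
  · have h1 := Nat.mul_le_mul_left k (delannoyF_le_card_pairedFacets h k)
    rw [mul_assoc, mul_assoc] at hle
    exact h1.trans (Nat.le_of_mul_le_mul_left hle two_pos)

/-! ### Small cases and conclusion -/

theorem delannoyF_one_succ (n : ℕ) : delannoyF 1 (n + 1) = 2 * (n + 2) := by
  rw [show (1 : ℕ) = 0 + 1 from rfl, delannoyF_succ_succ, delannoy_zero_left]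
  have h : ∀ n, delannoy (0 + 1) n = 2 * n + 1 := by
    intro n
    rw [delannoy_eq_sum_range (n := 1) (by omega)]
    simp [Finset.sum_range_succ]
    ring
  rw [h]; ring

/-- For `n ≥ 2`, adjoining a cubic to a univariate polynomial gives `6 * n ≥ 4 * (n + 1)` solutions.
For `n = 1` such products give only `6`, so the explicit pair is needed. -/
theorem two_mul_delannoyF_one_le_Xi (n : ℕ) :
    ((2 * delannoyF 1 n : ℕ) : ℕ∞) ≤ Xi 2 (2 * n + 1) := by
  match n with
  | 0 =>
    rw [delannoyF_zero_right]
    have := natCast_mul_le_Xi (N := 1) (by simpa using one_le_Xi_zero 1) 1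
    simpa using this
  | 1 => exact HexanomialPair.eight_le_Xi
  | n + 2 =>
    rw [delannoyF_one_succ]
    have := natCast_mul_le_Xi (add_one_le_Xi_one (2 * n + 3)) 2
    refine le_trans ?_ this
    exact_mod_cast (by omega)

theorem two_mul_delannoyF_le_Xi {i : ℕ} (hi : 0 < i) (n : ℕ) :
    ((2 * delannoyF i n : ℕ) : ℕ∞) ≤ Xi (2 * i) (2 * n + 1) := by
  rcases Nat.lt_or_ge 1 i with h1 | h1
  · have hd : 2 * i = 2 * i - 1 + 1 := by omega
    rw [hd]
    rcases Nat.eq_zero_or_pos n with rfl | hn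
    · rw [delannoyF_zero_right]
      exact natCast_mul_le_Xi (N := 1) (by simpa using one_le_Xi_zero (2 * i - 1)) 1
    · rw [delannoyF_comm]
      exact natCast_mul_le_Xi (delannoyF_le_Xi hn h1) 1
  · obtain rfl : i = 1 := by omega
    exact two_mul_delannoyF_one_le_Xi n

theorem ennreal_div_mul_le_toENNReal {a b F N : ℕ} {x : ℕ∞} (hN : (N : ℕ∞) ≤ x)
    (h : a * F ≤ b * N) : (a : ℝ≥0∞) / (b : ℝ≥0∞) * (F : ℝ≥0∞) ≤ (x : ℝ≥0∞) := by
  have h1 : (N : ℝ≥0∞) ≤ (x : ℝ≥0∞) := by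
    have := ENat.toENNReal_mono hN
    simpa using this
  refine le_trans ?_ h1
  rw [mul_comm, ← mul_div_assoc]
  refine ENNReal.div_le_of_le_mul ?_
  rw [mul_comm, mul_comm (N : ℝ≥0∞)]
  exact_mod_cast h

theorem corollary6p6 :
    (∀ h k : ℕ, 0 < h → 1 < k →
      Xi (2 * k - 1) (2 * h) ≤ Xi (2 * k) (2 * h) ∧
      (delannoyF h k : ℕ∞) ≤ Xi (2 * k - 1) (2 * h) ∧
      delannoy h k ≤ delannoyF h k) ∧
    (∀ i j : ℕ, 0 < i → 0 < j →
      (1 < i → (delannoyF i j : ℕ∞) ≤ Xi (2 * i - 1) (2 * j)) ∧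
      (j : ℝ≥0∞) / ((i : ℝ≥0∞) + (j : ℝ≥0∞)) * (delannoyF i j : ℝ≥0∞) ≤
        (Xi (2 * i - 1) (2 * j - 1) : ℝ≥0∞) ∧
      ((i : ℝ≥0∞) + 1) / ((i : ℝ≥0∞) + (j : ℝ≥0∞) + 1) * (delannoyF (i + 1) j : ℝ≥0∞) ≤
        (Xi (2 * i) (2 * j) : ℝ≥0∞) ∧
      (2 * delannoyF i (j - 1) : ℕ∞) ≤ Xi (2 * i) (2 * j - 1)) := by
  refine ⟨fun h k hh hk => ⟨?_, delannoyF_le_Xi hh hk, delannoy_le_delannoyF h k⟩,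
    fun i j hi hj => ⟨fun hi1 => ?_, ?_, ?_, ?_⟩⟩
  · have := Xi_le_Xi_succ (2 * k - 1) (2 * h)
    rwa [show 2 * k - 1 + 1 = 2 * k by omega] at this
  · rw [delannoyF_comm]
    exact delannoyF_le_Xi hj hi1
  · have key : ∃ N : ℕ, (N : ℕ∞) ≤ Xi (2 * i - 1) (2 * j - 1) ∧
        j * delannoyF i j ≤ (i + j) * N := by
      rcases Nat.lt_or_ge 1 i with h1 | h1
      · rw [delannoyF_comm, add_comm i j]
        exact exists_delannoyF_mul_le_of_notMem hj h1
      · obtain rfl : i = 1 := by omega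
        obtain ⟨n, rfl⟩ : ∃ n, j = n + 1 := ⟨j - 1, by omega⟩
        -- For `i = 1` the bound equals `2 * j`, attained by a univariate polynomial with simple
        -- positive roots.
        refine ⟨2 * (n + 1) - 1 + 1, add_one_le_Xi_one _, ?_⟩
        rw [delannoyF_one_succ, show 2 * (n + 1) - 1 + 1 = 2 * (n + 1) by omega]
        exact le_of_eq (by ring)
    obtain ⟨N, hN, hle⟩ := key
    simpa using ennreal_div_mul_le_toENNReal hN hle
  · obtain ⟨N, hN, hle⟩ := exists_delannoyF_mul_le_of_mem (h := j) (k := i + 1) hj (by omega)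
    rw [show 2 * (i + 1) - 2 = 2 * i by omega] at hN
    rw [delannoyF_comm, show j + (i + 1) = i + j + 1 by ring] at hle
    simpa using ennreal_div_mul_le_toENNReal hN hle
  · have := two_mul_delannoyF_le_Xi hi (j - 1)
    rw [show 2 * (j - 1) + 1 = 2 * j - 1 by omega] at this
    exact_mod_cast this
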